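/- Let $q>0$ and let $A$ be the unbounded operator on $L^2[0,1]$ (complex-valued functions) given by $$Af=-if'',\qquad D(A)=\{f\in H^2(0,1)\ :\ f'(0)=-iq\,f(0),\ f'(1)=0\}.$$ Then: 1. $A$ has an everywhere defined bounded inverse $A^{-1}$ on $L^2[0,1]$, and $A^{-1}$ is compact. 2. The spectrum $\sigma(A)$ consists of isolated eigenvalues of finite algebraic multiplicity, i.e. every $z\in\sigma(A)$ is an eigenvalue, is an isolated point of $\sigma(A)$, and $\bigcup_{k\ge 1}\ker (A-zI)^k$ is finite-dimensional. 3. All eigenvalues of $A$ have positive real part and lie in a vertical strip: there is $c\in\mathbb R$ with $0<\operatorname{Re} z\le c$ for every eigenvalue $z$ of $A$. 4. There are sequences $(\mu_n)_{n\ge 0}$ in $\mathbb C$ and $(\phi_n)_{n\ge0}$ in $D(A)\setminus\{0\}$ with $A\phi_n=\mu_n\phi_n$ for all $n$, such that every eigenvalue of $A$ occurs among the $\mu_n$, $$\mu_n=2q+i(n\pi)^2+O(n^{-2})\qquad (n\to\infty),$$ and $(\phi_n)_{n\ge 0}$ is a Riesz basis of $L^2[0,1]$, i.e. the image of the standard orthonormal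 basis of $\ell^2$ under a bounded, boundedly invertible linear map $\ell^2\to L^2[0,1]$. 5. $A$ is the generator of a strongly continuous group $(T_t)_{t\in\mathbb R}$ of bounded operators on $L^2[0,1]$, and the point observation $C_mf=f(1)$, $f\in D(A)$, is an admissible observation operator for this group: $C_m$ is bounded from $D(A)$ with the graph norm to $\mathbb C$, and for every $\tau>0$ there is $m_\tau>0$ such that $$\int_0^\tau |C_m T_t f|^2\,dt\le m_\tau\|f\|^2\qquad\text{for all } f\in D(A).$$ -/

import Mathlib

open MeasureTheory Set Filter Topology Asymptotics
open scoped ContDiff ENNReal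

noncomputable section

namespace SchrodingerGroup

section Abstract

variable {E : Type*} [NormedAddCommGroup E] [NormedSpace ℂ E]

/-- The bounded operator `R` is the (everywhere defined, two-sided) inverse of the unbounded
operator `A`. -/
def IsBoundedInverse (A : E →ₗ.[ℂ] E) (R : E →L[ℂ] E) : Prop :=
  (∀ y : E, ∃ h : R y ∈ A.domain, A ⟨R y, h⟩ = y) ∧ ∀ x : A.domain, R (A x) = x

/-- The bounded operator `R` is the inverse of `z I - A`. -/
def IsResolventAt (A : E →ₗ.[ℂ] E) (z : ℂ) (R : E →L[ℂ] E) : Prop :=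
  (∀ y : E, ∃ h : R y ∈ A.domain, z • R y - A ⟨R y, h⟩ = y) ∧
    ∀ x : A.domain, R (z • (x : E) - A x) = x

/-- The spectrum of an unbounded operator: the complement of its resolvent set. -/
def opSpectrum (A : E →ₗ.[ℂ] E) : Set ℂ :=
  {z | ¬ ∃ R : E →L[ℂ] E, IsResolventAt A z R}

/-- `f` is an eigenvector of the unbounded operator `A` for the eigenvalue `z`. -/
def IsEigenvector (A : E →ₗ.[ℂ] E) (z : ℂ) (f : E) : Prop :=
  f ≠ 0 ∧ ∃ h : f ∈ A.domain, A ⟨f, h⟩ = z • f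

/-- `z` is an eigenvalue of the unbounded operator `A`. -/
def IsEigenvalue (A : E →ₗ.[ℂ] E) (z : ℂ) : Prop :=
  ∃ f : E, IsEigenvector A z f

/-- The kernel of `(A - z I) ^ k` (on its natural domain). -/
def kerPow (A : E →ₗ.[ℂ] E) (z : ℂ) : ℕ → Submodule ℂ E
  | 0 => ⊥
  | k + 1 => ((kerPow A z k).comap (A.toFun - z • A.domain.subtype)).map A.domain.subtype

/-- The root space of `A` at `z`, i.e. the span of the kernels of all `(A - z I) ^ k`; its
dimension is the algebraic multiplicity of `z`. -/
def rootSpace (A : E →ₗ.[ℂ] E) (z : ℂ) : Submodule ℂ E :=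
  ⨆ k : ℕ, kerPow A z k

/-- A sequence is a Riesz basis if an isomorphism (linear, bounded, with bounded inverse) of the
space onto `ℓ²` takes it to the standard orthonormal basis. -/
def IsRieszBasis (φ : ℕ → E) : Prop :=
  ∃ Q : E ≃L[ℂ] lp (fun _ : ℕ => ℂ) 2, ∀ n, Q (φ n) = lp.single 2 n (1 : ℂ)

variable (E) in
/-- A strongly continuous group of bounded operators. -/
structure C0Group where
  toFun : ℝ → E →L[ℂ] E
  map_zero : toFun 0 = ContinuousLinearMap.id ℂ E
  map_add : ∀ s t : ℝ, toFun (s + t) = (toFun s).comp (toFun t)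
  strongCont : ∀ x : E, Continuous fun t : ℝ => toFun t x

/-- `A` is the infinitesimal generator of `T`: `x ∈ D(A)` and `A x = y` if and only if
`(T t x - x) / t → y` as `t → 0`. -/
def IsGenerator (A : E →ₗ.[ℂ] E) (T : C0Group E) : Prop :=
  ∀ x y : E, (x, y) ∈ A.graph ↔
    Tendsto (fun t : ℝ => (t : ℂ)⁻¹ • (T.toFun t x - x)) (𝓝[≠] 0) (𝓝 y)

/-- The group leaves the domain of its generator invariant. -/
theorem IsGenerator.mem_domain {A : E →ₗ.[ℂ] E} {T : C0Group E} (hT : IsGenerator A T)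
    (x : A.domain) (s : ℝ) : T.toFun s x ∈ A.domain := by
  have h1 : ((x : E), A x) ∈ A.graph := LinearPMap.mem_graph A x
  have h2 := ((T.toFun s).continuous.tendsto (A x)).comp ((hT _ _).1 h1)
  have h3 : (T.toFun s x, T.toFun s (A x)) ∈ A.graph := by
    refine (hT _ _).2 (h2.congr fun t => ?_)
    have e : T.toFun s (T.toFun t x) = T.toFun t (T.toFun s x) := by
      rw [← ContinuousLinearMap.comp_apply, ← ContinuousLinearMap.comp_apply, ← T.map_add,
        ← T.map_add, add_comm]
    simp [e]
  exact LinearPMap.mem_domain_of_mem_graph h3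

/-- Admissibility of an observation operator `C : D(A) → Y` for the group `T` generated by `A`:
`C` is bounded for the graph norm of `A`, and for every `τ > 0` there is `m > 0` with
`∫₀^τ ‖C T_t x‖² dt ≤ m ‖x‖²` for all `x ∈ D(A)`. -/
def IsAdmissibleObservation {Y : Type*} [NormedAddCommGroup Y] [NormedSpace ℂ Y]
    {A : E →ₗ.[ℂ] E} {T : C0Group E} (hT : IsGenerator A T) (C : A.domain →ₗ[ℂ] Y) : Prop :=
  (∃ K : ℝ, ∀ x : A.domain, ‖C x‖ ≤ K * (‖(x : E)‖ + ‖A x‖)) ∧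
    ∀ τ : ℝ, 0 < τ → ∃ m : ℝ, 0 < m ∧ ∀ x : A.domain,
      ∫⁻ t in Icc 0 τ, ‖C ⟨T.toFun t x, hT.mem_domain x t⟩‖ₑ ^ 2 ≤
        ENNReal.ofReal (m * ‖(x : E)‖ ^ 2)

end Abstract

/-- The complex Hilbert space `L²[0,1]`. -/
abbrev L2I : Type := Lp ℂ 2 (volume.restrict (Icc (0 : ℝ) 1))

/-- `g ∈ L²` is the weak derivative of `f ∈ L²` on `(0,1)`. -/
def IsWeakDeriv (f g : L2I) : Prop :=
  ∀ θ : ℝ → ℝ, ContDiff ℝ ∞ θ → HasCompactSupport θ → tsupport θ ⊆ Ioo 0 1 →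
    ∫ x in Icc (0 : ℝ) 1, deriv θ x • f x = -∫ x in Icc (0 : ℝ) 1, θ x • g x

/-- `u` is a representative of `f` that is continuous on `[0,1]`. Any two agree on `[0,1]`. -/
def IsContRep (u : ℝ → ℂ) (f : L2I) : Prop :=
  ContinuousOn u (Icc 0 1) ∧ f =ᵐ[volume.restrict (Icc (0 : ℝ) 1)] u

theorem IsContRep.eqOn {u v : ℝ → ℂ} {f : L2I} (hu : IsContRep u f) (hv : IsContRep v f) :
    EqOn u v (Icc 0 1) :=
  Measure.eqOn_Icc_of_ae_eq volume zero_ne_one (hu.2.symm.trans hv.2) hu.1 hv.1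

theorem IsContRep.add {u v : ℝ → ℂ} {f g : L2I} (hu : IsContRep u f) (hv : IsContRep v g) :
    IsContRep (u + v) (f + g) :=
  ⟨hu.1.add hv.1, (Lp.coeFn_add f g).trans (hu.2.add hv.2)⟩

theorem IsContRep.smul {u : ℝ → ℂ} {f : L2I} (hu : IsContRep u f) (c : ℂ) :
    IsContRep (c • u) (c • f) :=
  ⟨hu.1.const_smul c, (Lp.coeFn_smul c f).trans (hu.2.const_smul c)⟩

theorem IsContRep.zero : IsContRep 0 0 :=
  ⟨continuousOn_const, Lp.coeFn_zero _ _ _⟩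

open Classical in
/-- The value at `x ∈ [0,1]` of the continuous representative of `f` (and `0` if `f` has none;
every element of `H¹(0,1)` has one). -/
def pointValue (x : ℝ) (f : L2I) : ℂ :=
  if h : ∃ u, IsContRep u f then h.choose x else 0

theorem pointValue_eq {u : ℝ → ℂ} {f : L2I} (hu : IsContRep u f) {x : ℝ}
    (hx : x ∈ Icc (0 : ℝ) 1) : pointValue x f = u x := by
  have h : ∃ u, IsContRep u f := ⟨u, hu⟩
  rw [pointValue, dif_pos h]
  exact h.choose_spec.eqOn hu hx

theorem integrable_smul (f : L2I) {θ : ℝ → ℝ} (hc : Continuous θ) :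
    Integrable (fun x => θ x • f x) (volume.restrict (Icc (0 : ℝ) 1)) := by
  have hf : IntegrableOn f (Icc (0 : ℝ) 1) := (Lp.memLp f).integrable (by norm_num)
  exact hf.continuousOn_smul hc.continuousOn isCompact_Icc

theorem continuous_deriv {θ : ℝ → ℝ} (hθ : ContDiff ℝ ∞ θ) : Continuous (deriv θ) :=
  hθ.continuous_deriv (by simp)

theorem integral_smul_add (f g : L2I) {θ : ℝ → ℝ} (hc : Continuous θ) :
    ∫ x in Icc (0 : ℝ) 1, θ x • (f + g : L2I) x =
      (∫ x in Icc (0 : ℝ) 1, θ x • f x) + ∫ x in Icc (0 : ℝ) 1, θ x • g x := by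
  rw [← integral_add (integrable_smul f hc) (integrable_smul g hc)]
  refine integral_congr_ae ?_
  filter_upwards [Lp.coeFn_add f g] with x hx
  rw [hx, Pi.add_apply, smul_add]

theorem integral_smul_smul (c : ℂ) (f : L2I) (θ : ℝ → ℝ) :
    ∫ x in Icc (0 : ℝ) 1, θ x • (c • f : L2I) x = c • ∫ x in Icc (0 : ℝ) 1, θ x • f x := by
  rw [← integral_smul]
  refine integral_congr_ae ?_
  filter_upwards [Lp.coeFn_smul c f] with x hx
  rw [hx, Pi.smul_apply, smul_comm]

theorem IsWeakDeriv.add {f g f' g' : L2I} (hf : IsWeakDeriv f f') (hg : IsWeakDeriv g g') :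
    IsWeakDeriv (f + g) (f' + g') := by
  intro θ h1 h2 h3
  rw [integral_smul_add f g (continuous_deriv h1), integral_smul_add f' g' h1.continuous,
    hf θ h1 h2 h3, hg θ h1 h2 h3, neg_add]

theorem IsWeakDeriv.smul {f f' : L2I} (hf : IsWeakDeriv f f') (c : ℂ) :
    IsWeakDeriv (c • f) (c • f') := by
  intro θ h1 h2 h3
  rw [integral_smul_smul, integral_smul_smul, hf θ h1 h2 h3, smul_neg]

theorem IsWeakDeriv.zero : IsWeakDeriv 0 0 := by
  intro θ _ _ _
  have h (η : ℝ → ℝ) : ∫ x in Icc (0 : ℝ) 1, η x • (0 : L2I) x = 0 := by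
    have e := integral_smul_smul 0 0 η
    rwa [zero_smul, zero_smul] at e
  rw [h, h, neg_zero]

/-- Weak derivatives are unique. -/
theorem IsWeakDeriv.unique {f g g' : L2I} (h : IsWeakDeriv f g) (h' : IsWeakDeriv f g') :
    g = g' := by
  have key : ∀ᵐ x ∂(volume.restrict (Icc (0 : ℝ) 1)), x ∈ Ioo (0 : ℝ) 1 → g x - g' x = 0 := by
    refine isOpen_Ioo.ae_eq_zero_of_integral_contDiff_smul_eq_zero ?_ ?_
    · exact (((Lp.memLp g).sub (Lp.memLp g')).integrable
        (by norm_num)).locallyIntegrable.locallyIntegrableOn _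
    · intro θ h1 h2 h3
      have e : ∫ x in Icc (0 : ℝ) 1, θ x • (g x - g' x) =
          ∫ x in Icc (0 : ℝ) 1, (θ x • g x - θ x • g' x) := by
        simp only [smul_sub]
      rw [e, integral_sub (integrable_smul g h1.continuous) (integrable_smul g' h1.continuous),
        sub_eq_zero]
      exact neg_injective ((h θ h1 h2 h3).symm.trans (h' θ h1 h2 h3))
  refine Lp.ext ?_
  have hI : ∀ᵐ x ∂(volume.restrict (Icc (0 : ℝ) 1)), x ∈ Ioo (0 : ℝ) 1 := by
    rw [← restrict_Ioo_eq_restrict_Icc]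
    exact ae_restrict_mem measurableSet_Ioo
  filter_upwards [key, hI] with x hx hx'
  exact sub_eq_zero.1 (hx hx')

/-- The domain of the Schrödinger operator: `f ∈ H²(0,1)` (so `f` has weak derivatives
`f' = g` and `f'' = k` in `L²`) with the boundary conditions `f'(0) = -i q f(0)` and `f'(1) = 0`,
read on the continuous representatives `u` of `f` and `v` of `f'`. -/
def domA (q : ℝ) : Submodule ℂ L2I where
  carrier := {f | ∃ g k : L2I, ∃ u v : ℝ → ℂ, IsWeakDeriv f g ∧ IsWeakDeriv g k ∧
    IsContRep u f ∧ IsContRep v g ∧ v 0 = -Complex.I * q * u 0 ∧ v 1 = 0}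
  add_mem' := by
    rintro f₁ f₂ ⟨g₁, k₁, u₁, v₁, a₁, b₁, c₁, d₁, e₁, z₁⟩ ⟨g₂, k₂, u₂, v₂, a₂, b₂, c₂, d₂, e₂, z₂⟩
    refine ⟨g₁ + g₂, k₁ + k₂, u₁ + u₂, v₁ + v₂, a₁.add a₂, b₁.add b₂, c₁.add c₂, d₁.add d₂, ?_, ?_⟩
    · simp only [Pi.add_apply, e₁, e₂]
      ring
    · simp [z₁, z₂]
  zero_mem' := ⟨0, 0, 0, 0, .zero, .zero, .zero, .zero, by simp, rfl⟩
  smul_mem' := by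
    rintro c f ⟨g, k, u, v, a, b, hu, hv, e, z⟩
    refine ⟨c • g, c • k, c • u, c • v, a.smul c, b.smul c, hu.smul c, hv.smul c, ?_, ?_⟩
    · simp only [Pi.smul_apply, smul_eq_mul, e]
      ring
    · simp [z]

theorem exists_second_deriv {q : ℝ} (f : domA q) :
    ∃ k : L2I, ∃ g : L2I, IsWeakDeriv f g ∧ IsWeakDeriv g k := by
  obtain ⟨g, k, _, _, a, b, _⟩ := f.2
  exact ⟨k, g, a, b⟩

/-- The second weak derivative `f''`. -/
def secondDeriv {q : ℝ} (f : domA q) : L2I := (exists_second_deriv f).choose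

theorem secondDeriv_eq {q : ℝ} (f : domA q) {g k : L2I} (hg : IsWeakDeriv f g)
    (hk : IsWeakDeriv g k) : secondDeriv f = k := by
  obtain ⟨g', hg', hk'⟩ := (exists_second_deriv f).choose_spec
  obtain rfl := hg.unique hg'
  exact IsWeakDeriv.unique hk' hk

/-- The operator `A f = -i f''` on the domain `domA q`. -/
def opA (q : ℝ) : L2I →ₗ.[ℂ] L2I where
  domain := domA q
  toFun :=
    { toFun := fun f => -Complex.I • secondDeriv f
      map_add' := fun f₁ f₂ => by
        obtain ⟨g₁, k₁, _, _, a₁, b₁, _⟩ := f₁.2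
        obtain ⟨g₂, k₂, _, _, a₂, b₂, _⟩ := f₂.2
        rw [secondDeriv_eq f₁ a₁ b₁, secondDeriv_eq f₂ a₂ b₂,
          secondDeriv_eq (f₁ + f₂) (a₁.add a₂) (b₁.add b₂), smul_add]
      map_smul' := fun c f => by
        obtain ⟨g, k, _, _, a, b, _⟩ := f.2
        rw [secondDeriv_eq f a b, secondDeriv_eq (c • f) (a.smul c) (b.smul c), RingHom.id_apply,
          smul_comm] }

/-- The point observation `C_m f = f(1)` on the domain of `A`. -/
def obsC (q : ℝ) : (opA q).domain →ₗ[ℂ] ℂ where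
  toFun f := pointValue 1 f
  map_add' f₁ f₂ := by
    obtain ⟨_, _, u₁, _, _, _, c₁, _⟩ := f₁.2
    obtain ⟨_, _, u₂, _, _, _, c₂, _⟩ := f₂.2
    have h1 : (1 : ℝ) ∈ Icc (0 : ℝ) 1 := by simp
    rw [pointValue_eq c₁ h1, pointValue_eq c₂ h1, Submodule.coe_add,
      pointValue_eq (c₁.add c₂) h1, Pi.add_apply]
  map_smul' c f := by
    obtain ⟨_, _, u, _, _, _, hu, _⟩ := f.2
    have h1 : (1 : ℝ) ∈ Icc (0 : ℝ) 1 := by simp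
    rw [pointValue_eq hu h1, Submodule.coe_smul, pointValue_eq (hu.smul c) h1, Pi.smul_apply,
      RingHom.id_apply]

end SchrodingerGroup

end

open SchrodingerGroup

/-! The condition at 1 forces eigenfunctions to be multiples of cos (w (1 - x)) with eigenvalue i
w², and the condition at 0 becomes w sin w = -i q cos w (`IsCharRoot`). One root w_n is found in
each half-strip n π < Re w < n π + π/2, Im w < 0. Since Re (i w²) = -2 Re w Im w, its location makes
the eigenvalue's real part positive. Writing δ = w_n - n π, the equation keeps its form, w_n sin δ =
-i q cos δ, so w_n δ ≈ -i q and i w_n² = 2 q + i (n π)² + O(n⁻²).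

Roots are never counted. The normalized eigenfunctions φ_n differ in norm by O(1/n) from the Neumann
basis built on cos (n π (1 - x)), so the map sending that basis to (φ_n) is 1 + K with K compact.
For the bilinear form ∫ f g, in which A is symmetric, distinct φ_n are orthogonal, and ∫ φ_n² ≠ 0
because 2 w_n + sin (2 w_n) ≠ 0. This biorthogonality makes 1 + K injective, hence invertible by the
Fredholm alternative (`exists_equiv_of_quadratically_close`, `exists_rieszBasis`). The same pairing
shows that A multiplies the n-th coordinate by μ_n = i w_n². As A is onto and no μ_n vanishes, A is
exactly the maximal multiplication operator (`isDiagonal_opA`); in particular no eigenvalue has been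
missed.

The remaining spectral and semigroup claims concern a diagonal operator on ℓ² with |μ_n| → ∞ and
bounded real parts. For admissibility, f(1) is controlled by ‖A f‖, which allows termwise
evaluation: C_m T_t f = ∑ a_n exp (t μ_n) with (a_n) square summable. The functions exp (i (n π)² t)
are orthogonal over the period 2/π, and the deviations of μ_n from 2 q + i (n π)² are square
summable, so the L² norm on [0, τ] of every partial sum is bounded uniformly; Fatou's lemma passes
to the limit. -/

namespace SchrodingerGroup

/-! ### Existence of characteristic roots -/

/-- The odd, strictly increasing function `β ↦ |β| sinh (2β)`. -/
noncomputable def absMulSinh (β : ℝ) : ℝ := |β| * Real.sinh (2 * β)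

theorem continuous_absMulSinh : Continuous absMulSinh := by
  unfold absMulSinh; fun_prop

theorem absMulSinh_neg (β : ℝ) : absMulSinh (-β) = -absMulSinh β := by
  simp [absMulSinh]

theorem absMulSinh_of_nonneg {β : ℝ} (h : 0 ≤ β) : absMulSinh β = β * Real.sinh (2 * β) := by
  rw [absMulSinh, abs_of_nonneg h]

theorem strictMono_absMulSinh : StrictMono absMulSinh := by
  have hmono : StrictMonoOn absMulSinh (Ici 0) := by
    intro x hx y hy hxy
    rw [absMulSinh_of_nonneg hx, absMulSinh_of_nonneg hy]
    have hs : Real.sinh (2 * x) < Real.sinh (2 * y) := Real.sinh_lt_sinh.2 (by linarith)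
    have hx' : (0 : ℝ) ≤ x := hx
    have h0 : 0 ≤ Real.sinh (2 * x) := Real.sinh_nonneg_iff.2 (by linarith)
    exact mul_lt_mul'' hxy hs hx' h0
  exact strictMono_of_odd_strictMonoOn_nonneg absMulSinh_neg hmono

theorem tendsto_absMulSinh_atTop : Tendsto absMulSinh atTop atTop := by
  refine tendsto_atTop_mono' atTop ?_ tendsto_id
  filter_upwards [eventually_ge_atTop (1 : ℝ)] with β hβ
  rw [absMulSinh_of_nonneg (by linarith)]
  have : 2 * β ≤ Real.sinh (2 * β) := Real.self_le_sinh_iff.2 (by linarith)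
  simp only [id]
  nlinarith

theorem surjective_absMulSinh : Function.Surjective absMulSinh := by
  refine continuous_absMulSinh.surjective tendsto_absMulSinh_atTop ?_
  have h : absMulSinh = fun β => -absMulSinh (-β) := by
    funext β; rw [absMulSinh_neg, neg_neg]
  rw [h]
  exact tendsto_neg_atTop_atBot.comp (tendsto_absMulSinh_atTop.comp tendsto_neg_atBot_atTop)

/-- The absolute value makes the even function β sinh (2β) odd without changing it for β ≥ 0, so it
becomes a homeomorphism of the whole line. This lets b be solved for continuously from a sin (2a) =
b sinh (2b). -/
theorem exists_continuous_rightInverse_absMulSinh :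
    ∃ k : ℝ → ℝ, Continuous k ∧ ∀ s, absMulSinh (k s) = s := by
  let e := strictMono_absMulSinh.orderIsoOfSurjective _ surjective_absMulSinh
  exact ⟨e.symm, e.symm.continuous, fun s => e.apply_symm_apply s⟩

/-- The two equations are the real and imaginary parts of the characteristic equation at w = a - i b
after multiplication by cos of the conjugate of w. The first defines b as a continuous function β of
a; the intermediate value theorem along this curve gives the second. -/
theorem exists_real_root {q : ℝ} (hq : 0 < q) (n : ℕ) :
    ∃ a b : ℝ, n * Real.pi < a ∧ a < n * Real.pi + Real.pi / 2 ∧ 0 < b ∧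
      a * Real.sin (2 * a) = b * Real.sinh (2 * b) ∧
      a * Real.sinh (2 * b) + b * Real.sin (2 * a) =
        q * (Real.cos (2 * a) + Real.cosh (2 * b)) := by
  have hpi := Real.pi_pos
  obtain ⟨k, hk, hks⟩ := exists_continuous_rightInverse_absMulSinh
  have hk0 : k 0 = 0 := by
    apply strictMono_absMulSinh.injective
    rw [hks]; simp [absMulSinh]
  have hkpos {s : ℝ} (hs : 0 < s) : 0 < k s := by
    rw [← strictMono_absMulSinh.lt_iff_lt, hks]; simpa [absMulSinh] using hs
  set β : ℝ → ℝ := fun a => k (a * Real.sin (2 * a)) with hβ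
  have hβc : Continuous β := by fun_prop
  set H : ℝ → ℝ := fun a => a * Real.sinh (2 * β a) + β a * Real.sin (2 * a) -
    q * (Real.cos (2 * a) + Real.cosh (2 * β a)) with hH
  have hHc : Continuous H := by fun_prop
  have hn : (0 : ℝ) ≤ n * Real.pi := by positivity
  have hsin {a : ℝ} (h1 : n * Real.pi < a) (h2 : a < n * Real.pi + Real.pi / 2) :
      0 < Real.sin (2 * a) := by
    have h := Real.sin_pos_of_pos_of_lt_pi (x := 2 * a - n * (2 * Real.pi)) (by linarith)
      (by linarith)
    rwa [Real.sin_sub_nat_mul_two_pi] at h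
  have hβpos {a : ℝ} (h1 : n * Real.pi < a) (h2 : a < n * Real.pi + Real.pi / 2) : 0 < β a :=
    hkpos (mul_pos (by linarith) (hsin h1 h2))
  have hβeq {a : ℝ} (h1 : n * Real.pi < a) (h2 : a < n * Real.pi + Real.pi / 2) :
      a * Real.sin (2 * a) = β a * Real.sinh (2 * β a) := by
    rw [← absMulSinh_of_nonneg (hβpos h1 h2).le]; exact (hks _).symm
  have h2n : 2 * (n * Real.pi) = n * (2 * Real.pi) := by ring
  -- At the left end β = 0 and H = -2 q.
  have hleft : H (n * Real.pi) < 0 := by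
    have e1 : Real.sin (2 * (n * Real.pi)) = 0 := by
      rw [h2n]; simpa using Real.sin_add_nat_mul_two_pi 0 n
    have e2 : Real.cos (2 * (n * Real.pi)) = 1 := by
      rw [h2n]; exact Real.cos_nat_mul_two_pi n
    simp only [hH, hβ, e1, e2, mul_zero, hk0]
    simp; linarith
  -- near the right end point
  set r := n * Real.pi + Real.pi / 2 with hr
  have hβr : β r = 0 := by
    have e1 : Real.sin (2 * r) = 0 := by
      have : 2 * r = Real.pi + n * (2 * Real.pi) := by rw [hr]; ring
      rw [this, Real.sin_add_nat_mul_two_pi, Real.sin_pi]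
    simp only [hβ, e1, mul_zero, hk0]
  obtain ⟨a₁, ha₁l, ha₁r, hpos⟩ : ∃ a₁, n * Real.pi < a₁ ∧ a₁ < r ∧ 0 < H a₁ := by
    -- At the right end H itself vanishes, so its sign must be read off nearby. This inequality,
    -- true near r since β r = 0, is what the comparison in `key` needs.
    have hev : ∀ᶠ a in 𝓝[<] r, q * β a * (1 + a) < a ^ 2 := by
      apply Filter.Eventually.filter_mono nhdsWithin_le_nhds
      have hc : ContinuousAt (fun a => a ^ 2 - q * β a * (1 + a)) r := by fun_prop
      have : 0 < r ^ 2 - q * β r * (1 + r) := by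
        rw [hβr]; have : 0 < r := by linarith
        simp; positivity
      filter_upwards [hc.eventually_const_lt this] with a ha
      linarith
    have hev2 : ∀ᶠ a in 𝓝[<] r, a ∈ Ioo (n * Real.pi + Real.pi / 4) r :=
      Ioo_mem_nhdsLT (by linarith)
    obtain ⟨a, ha, hal, har⟩ := (hev.and hev2).exists
    have hal' : n * Real.pi < a := by linarith
    refine ⟨a, hal', har, ?_⟩
    have ha0 : 0 < a := by linarith
    have hs := hsin hal' har
    have hb := hβpos hal' har
    have heq := hβeq hal' har
    set b := β a
    have hcos : Real.cos (2 * a) ≤ 0 := by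
      have h := Real.cos_nonpos_of_pi_div_two_le_of_le (x := 2 * a - n * (2 * Real.pi))
        (by linarith) (by linarith)
      rwa [Real.cos_sub_nat_mul_two_pi] at h
    have hs1 := Real.sin_le_one (2 * a)
    have hc1 := Real.neg_one_le_cos (2 * a)
    have hsc := Real.sin_sq_add_cos_sq (2 * a)
    -- As cos ≤ 0, sin² = (1 - cos) (1 + cos) ≥ (1 + cos)².
    have hcos' : Real.cos (2 * a) ≤ -1 + Real.sin (2 * a) := by nlinarith
    have hsh : 0 < Real.sinh (2 * b) := Real.sinh_pos_iff.2 (by linarith)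
    -- With cosh (2b) - 1 = 2 sinh² b and sinh (2b) = 2 sinh b cosh b, this reduces to sinh b ≤ b
    -- cosh b.
    have hcosh : Real.cosh (2 * b) - 1 ≤ b * Real.sinh (2 * b) := by
      rw [Real.cosh_two_mul, Real.sinh_two_mul]
      have h1 := Real.cosh_sq b
      have hsb : 0 < Real.sinh b := Real.sinh_pos_iff.2 hb
      have h2 : Real.sinh b ≤ b * Real.cosh b := by
        have hf : MonotoneOn (fun x => x * Real.cosh x - Real.sinh x) (Ici 0) := by
          apply monotoneOn_of_deriv_nonneg (convex_Ici 0)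
          · fun_prop
          · fun_prop
          · intro x hx
            rw [interior_Ici, mem_Ioi] at hx
            have hd : HasDerivAt (fun x => x * Real.cosh x - Real.sinh x)
                (1 * Real.cosh x + x * Real.sinh x - Real.cosh x) x :=
              ((hasDerivAt_id x).mul (Real.hasDerivAt_cosh x)).sub (Real.hasDerivAt_sinh x)
            rw [hd.deriv]
            have := Real.sinh_pos_iff.2 hx
            nlinarith
        have := hf (self_mem_Ici) (mem_Ici.2 hb.le) hb.le
        simpa using this
      nlinarith
    have key : q * (Real.cos (2 * a) + Real.cosh (2 * b)) < a * Real.sinh (2 * b) := by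
      have e : Real.cos (2 * a) + Real.cosh (2 * b) ≤
          b * Real.sinh (2 * b) + Real.sin (2 * a) := by linarith
      -- Multiplying by a turns the term sin (2a) into b sinh (2b), by the equation defining b.
      have e2 : a * (Real.cos (2 * a) + Real.cosh (2 * b)) ≤
          (a + 1) * (b * Real.sinh (2 * b)) := by nlinarith
      have e3 : q * b * (1 + a) * Real.sinh (2 * b) < a ^ 2 * Real.sinh (2 * b) :=
        mul_lt_mul_of_pos_right ha hsh
      have e4 := mul_le_mul_of_nonneg_left e2 hq.le
      have e5 : a * (q * (Real.cos (2 * a) + Real.cosh (2 * b))) <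
          a * (a * Real.sinh (2 * b)) := by linarith
      exact lt_of_mul_lt_mul_left e5 ha0.le
    simp only [hH]
    have := mul_pos hb hs
    linarith
  obtain ⟨a, ⟨hal, har⟩, ha⟩ := intermediate_value_Ioo ha₁l.le hHc.continuousOn ⟨hleft, hpos⟩
  have har' := har.trans ha₁r
  exact ⟨a, β a, hal, har', hβpos hal har', hβeq hal har', by simp only [hH] at ha; linarith⟩

/-- The characteristic equation of the boundary value problem `-i f'' = i w² f`,
`f'(0) = -i q f(0)`, `f'(1) = 0`. -/
def IsCharRoot (q : ℝ) (w : ℂ) : Prop :=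
  w * Complex.sin w = -Complex.I * q * Complex.cos w

theorem exists_isCharRoot {q : ℝ} (hq : 0 < q) (n : ℕ) :
    ∃ w : ℂ, n * Real.pi < w.re ∧ w.re < n * Real.pi + Real.pi / 2 ∧ w.im < 0 ∧
      IsCharRoot q w := by
  obtain ⟨a, b, h1, h2, hb, e1, e2⟩ := exists_real_root hq n
  refine ⟨⟨a, -b⟩, h1, h2, by simpa using hb, ?_⟩
  set w : ℂ := ⟨a, -b⟩
  have hw : w = a - b * Complex.I := by
    apply Complex.ext <;> simp [w]
  -- The conjugate of w: multiplying by cos of it turns sin w and cos w into functions of 2a and 2b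
  -- only. The factor is nonzero because cosh (2b) > 1.
  set wc : ℂ := a + b * Complex.I
  have hsc : Complex.sin w * Complex.cos wc =
      (Complex.sin (2 * a) - Complex.I * Complex.sinh (2 * b)) / 2 := by
    have s1 := Complex.sin_add w wc
    have s2 := Complex.sin_sub w wc
    have t1 : w + wc = 2 * a := by rw [hw]; ring
    have t2 : w - wc = -(2 * b * Complex.I) := by rw [hw]; ring
    rw [t1] at s1
    rw [t2, Complex.sin_neg, Complex.sin_mul_I] at s2
    linear_combination (-1 / 2) * s1 - (1 / 2) * s2
  have hcc : Complex.cos w * Complex.cos wc =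
      (Complex.cos (2 * a) + Complex.cosh (2 * b)) / 2 := by
    have s1 := Complex.cos_add w wc
    have s2 := Complex.cos_sub w wc
    have t1 : w + wc = 2 * a := by rw [hw]; ring
    have t2 : w - wc = -(2 * b * Complex.I) := by rw [hw]; ring
    rw [t1] at s1
    rw [t2, Complex.cos_neg, Complex.cos_mul_I] at s2
    linear_combination (-1 / 2) * s1 - (1 / 2) * s2
  have hne : Complex.cos wc ≠ 0 := by
    intro h0
    rw [h0, mul_zero] at hcc
    have hr : Real.cos (2 * a) + Real.cosh (2 * b) = 0 := by
      have : ((Real.cos (2 * a) + Real.cosh (2 * b) : ℝ) : ℂ) = 0 := by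
        push_cast; linear_combination -2 * hcc
      exact_mod_cast this
    have h3 : 1 < Real.cosh (2 * b) := Real.one_lt_cosh.2 (by positivity)
    have := Real.neg_one_le_cos (2 * a)
    linarith
  have e1' : (a : ℂ) * Complex.sin (2 * a) = b * Complex.sinh (2 * b) := by exact_mod_cast e1
  have e2' : (a : ℂ) * Complex.sinh (2 * b) + b * Complex.sin (2 * a) =
      q * (Complex.cos (2 * a) + Complex.cosh (2 * b)) := by exact_mod_cast e2
  apply mul_right_cancel₀ hne
  calc w * Complex.sin w * Complex.cos wc = w * (Complex.sin w * Complex.cos wc) := by ring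
    _ = -Complex.I * q * (Complex.cos w * Complex.cos wc) := by
      rw [hsc, hcc, hw]
      linear_combination (1 / 2) * e1' - (Complex.I / 2) * e2' +
        (b / 2 * Complex.sinh (2 * b)) * Complex.I_sq
    _ = _ := by ring

/-- Roots in the open quadrant are simple: `2 w + sin (2 w)` does not vanish. -/
theorem two_mul_add_sin_ne_zero {n : ℕ} {w : ℂ} (h1 : n * Real.pi < w.re)
    (h2 : w.re < n * Real.pi + Real.pi / 2) : 2 * w + Complex.sin (2 * w) ≠ 0 := by
  intro h
  have hs : 0 < Real.sin (2 * w.re) := by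
    have h := Real.sin_pos_of_pos_of_lt_pi (x := 2 * w.re - n * (2 * Real.pi)) (by linarith)
      (by linarith)
    rwa [Real.sin_sub_nat_mul_two_pi] at h
  have hpi := Real.pi_pos
  have hn : (0 : ℝ) ≤ n * Real.pi := by positivity
  have h3 := congrArg Complex.re h
  have h4 : (Complex.sin (2 * w)).re = Real.sin (2 * w.re) * Real.cosh (2 * w.im) := by
    rw [Complex.sin_eq]
    simp [← Complex.ofReal_sin, ← Complex.ofReal_cosh, ← Complex.ofReal_cos, ← Complex.ofReal_sinh,
      -Complex.ofReal_ofNat, -Complex.ofReal_mul]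
  have h5 := mul_pos hs (Real.cosh_pos (2 * w.im))
  simp only [Complex.add_re, Complex.mul_re, h4] at h3
  simp at h3
  linarith

/-! ### Asymptotics of the roots and eigenvalues -/

theorem IsCharRoot.shift {q : ℝ} {w : ℂ} (h : IsCharRoot q w) (n : ℕ) :
    w * Complex.sin (w - n * Real.pi) = -Complex.I * q * Complex.cos (w - n * Real.pi) := by
  have hs := Complex.sin_antiperiodic.sub_nat_mul_eq (x := w) n
  have hc := Complex.cos_antiperiodic.sub_nat_mul_eq (x := w) n
  rw [hs, hc]
  unfold IsCharRoot at h
  linear_combination (-1) ^ n * h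

theorem norm_sin_sq (z : ℂ) : ‖Complex.sin z‖ ^ 2 = Real.sin z.re ^ 2 + Real.sinh z.im ^ 2 := by
  rw [Complex.sq_norm, Complex.normSq_apply, Complex.sin_eq]
  simp [← Complex.ofReal_sin, ← Complex.ofReal_cosh, ← Complex.ofReal_cos, ← Complex.ofReal_sinh]
  have h1 := Real.cosh_sq z.im
  have h2 := Real.sin_sq_add_cos_sq z.re
  linear_combination Real.sin z.re ^ 2 * h1 + Real.sinh z.im ^ 2 * h2

theorem norm_cos_sq (z : ℂ) : ‖Complex.cos z‖ ^ 2 = Real.cos z.re ^ 2 + Real.sinh z.im ^ 2 := by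
  rw [Complex.sq_norm, Complex.normSq_apply, Complex.cos_eq]
  simp [← Complex.ofReal_sin, ← Complex.ofReal_cosh, ← Complex.ofReal_cos, ← Complex.ofReal_sinh]
  have h1 := Real.cosh_sq z.im
  have h2 := Real.sin_sq_add_cos_sq z.re
  linear_combination Real.cos z.re ^ 2 * h1 + Real.sinh z.im ^ 2 * h2

theorem abs_le_abs_sinh (x : ℝ) : |x| ≤ |Real.sinh x| := by
  rw [Real.abs_sinh]
  exact Real.self_le_sinh_iff.2 (abs_nonneg x)

/-- From |sin z|² = sin² (Re z) + sinh² (Im z), Jordan's inequality with 2/π ≥ 1/2, and |sinh y| ≥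
|y|. -/
theorem norm_le_two_mul_norm_sin {z : ℂ} (h0 : 0 ≤ z.re) (h1 : z.re ≤ Real.pi / 2) :
    ‖z‖ ≤ 2 * ‖Complex.sin z‖ := by
  have hj := Real.mul_le_sin h0 h1
  have hpi := Real.pi_pos
  have hpi4 := Real.pi_le_four
  have hs : z.re ≤ 2 * Real.sin z.re := by
    have : 1 / 2 * z.re ≤ 2 / Real.pi * z.re := by
      gcongr ?_ * _
      rw [div_le_div_iff₀ (by norm_num) hpi]; linarith
    linarith
  have hb : z.im ^ 2 ≤ Real.sinh z.im ^ 2 := sq_le_sq.2 (abs_le_abs_sinh _)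
  apply le_of_sq_le_sq _ (by positivity)
  rw [mul_pow, norm_sin_sq, Complex.sq_norm, Complex.normSq_apply]
  have : z.re * z.re ≤ 2 * Real.sin z.re * (2 * Real.sin z.re) := mul_self_le_mul_self h0 hs
  nlinarith [sq_nonneg z.im]

theorem IsCharRoot.norm_mul_norm_sub_le {q : ℝ} {w : ℂ} {n : ℕ} (hq : 0 < q)
    (h : IsCharRoot q w) (h1 : n * Real.pi < w.re) (h2 : w.re < n * Real.pi + Real.pi / 2)
    (hn : q ≤ n) : ‖w‖ * ‖w - n * Real.pi‖ ≤ 4 * q := by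
  have hs := congrArg (fun z => ‖z‖ ^ 2) (h.shift n)
  set δ : ℂ := w - n * Real.pi
  have hre : δ.re = w.re - n * Real.pi := by
    simp [δ, ← Complex.ofReal_natCast, -Complex.ofReal_mul]
  simp only [norm_mul, mul_pow, norm_neg, Complex.norm_I, one_mul, Complex.norm_real,
    Real.norm_eq_abs, sq_abs] at hs
  have hδ : ‖δ‖ ≤ 2 * ‖Complex.sin δ‖ := norm_le_two_mul_norm_sin (by linarith) (by linarith)
  have hcs : ‖Complex.cos δ‖ ^ 2 ≤ 1 + ‖Complex.sin δ‖ ^ 2 := by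
    rw [norm_cos_sq, norm_sin_sq]
    have := Real.cos_sq_le_one δ.re
    nlinarith [sq_nonneg (Real.sin δ.re)]
  have hpi := Real.pi_gt_three
  have hw : 2 * q ≤ ‖w‖ := by
    have h3 := Complex.re_le_norm w
    nlinarith
  have hw2 : 4 * q ^ 2 ≤ ‖w‖ ^ 2 := by nlinarith
  -- The shifted equation gives |w|² |sin δ|² ≤ q² (1 + |sin δ|²). Since |w| ≥ 2 q, the last term is
  -- at most a quarter of the left side and is absorbed.
  have h5 : (‖w‖ * ‖Complex.sin δ‖) ^ 2 ≤ (2 * q) ^ 2 := by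
    have h6 := mul_le_mul_of_nonneg_left hcs (sq_nonneg q)
    have h7 := mul_le_mul_of_nonneg_right hw2 (sq_nonneg ‖Complex.sin δ‖)
    nlinarith
  have h8 := le_of_sq_le_sq h5 (by positivity)
  nlinarith [mul_le_mul_of_nonneg_left hδ (norm_nonneg w)]

theorem norm_one_sub_cos_le {z : ℂ} (h : ‖z‖ ≤ 1) : ‖1 - Complex.cos z‖ ≤ ‖z‖ ^ 2 := by
  have h1 := Complex.cos_bound h
  have h2 : 1 - Complex.cos z = z ^ 2 / 2 - (Complex.cos z - (1 - z ^ 2 / 2)) := by ring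
  rw [h2]
  refine (norm_sub_le _ _).trans ?_
  have h3 : ‖z ^ 2 / 2‖ = ‖z‖ ^ 2 / 2 := by simp
  rw [h3]
  have h0 := norm_nonneg z
  have h4 : ‖z‖ ^ 4 ≤ ‖z‖ ^ 2 := pow_le_pow_of_le_one h0 h (by norm_num)
  nlinarith [sq_nonneg ‖z‖]

theorem norm_sub_sin_le {z : ℂ} (h : ‖z‖ ≤ 1) : ‖z - Complex.sin z‖ ≤ ‖z‖ ^ 3 := by
  have h1 := Complex.sin_bound h
  have h2 : z - Complex.sin z = z ^ 3 / 6 - (Complex.sin z - (z - z ^ 3 / 6)) := by ring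
  rw [h2]
  refine (norm_sub_le _ _).trans ?_
  have h3 : ‖z ^ 3 / 6‖ = ‖z‖ ^ 3 / 6 := by simp
  rw [h3]
  have h0 := norm_nonneg z
  have h4 : ‖z‖ ^ 4 ≤ ‖z‖ ^ 3 := pow_le_pow_of_le_one h0 h (by norm_num)
  have h5 : 0 ≤ ‖z‖ ^ 3 := by positivity
  have h6 : ‖z‖ ^ 5 ≤ ‖z‖ ^ 3 := pow_le_pow_of_le_one h0 h (by norm_num)
  linarith

theorem IsCharRoot.norm_sub_nat_mul_pi_le {q : ℝ} {w : ℂ} {n : ℕ} (hq : 0 < q)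
    (h : IsCharRoot q w) (h1 : n * Real.pi < w.re) (h2 : w.re < n * Real.pi + Real.pi / 2)
    (hn : q ≤ n) : ‖w - n * Real.pi‖ ≤ 4 * q / n := by
  have h3 := h.norm_mul_norm_sub_le hq h1 h2 hn
  have hn0 : (0 : ℝ) < n := by linarith
  have hpi := Real.pi_gt_three
  have hw : (n : ℝ) ≤ ‖w‖ := by nlinarith [Complex.re_le_norm w]
  rw [le_div_iff₀ hn0]
  nlinarith [mul_le_mul_of_nonneg_right hw (norm_nonneg (w - n * Real.pi))]

theorem IsCharRoot.norm_eigenvalue_sub_le {q : ℝ} {w : ℂ} {n : ℕ} (hq : 0 < q)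
    (h : IsCharRoot q w) (h1 : n * Real.pi < w.re) (h2 : w.re < n * Real.pi + Real.pi / 2)
    (hn : 4 * q ≤ n) :
    ‖Complex.I * w ^ 2 - (2 * (q : ℂ) + Complex.I * ((n : ℂ) * (Real.pi : ℂ)) ^ 2)‖ ≤
      (10 * q + 1) * (4 * q) ^ 2 * ((n : ℝ) ^ 2)⁻¹ := by
  have h3 := h.norm_mul_norm_sub_le hq h1 h2 (by linarith)
  have h4 := h.norm_sub_nat_mul_pi_le hq h1 h2 (by linarith)
  have hs := h.shift n
  set δ : ℂ := w - n * Real.pi with hδ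
  have hn0 : (0 : ℝ) < n := by linarith
  have hδ1 : ‖δ‖ ≤ 1 := h4.trans ((div_le_one hn0).2 hn)
  -- Here w² - (n π)² = 2 w δ - δ², and the characteristic equation replaces the main part w sin δ
  -- of w δ by -i q cos δ, which produces 2 q. The cubic error δ - sin δ compensates the large
  -- factor w, as |w| |δ| ≤ 4 q.
  have e : Complex.I * w ^ 2 - (2 * (q : ℂ) + Complex.I * ((n : ℂ) * (Real.pi : ℂ)) ^ 2) =
      Complex.I * (2 * (Complex.I * q * (1 - Complex.cos δ) + w * (δ - Complex.sin δ)) - δ ^ 2) := by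
    have : (n : ℂ) * Real.pi = w - δ := by rw [hδ]; ring
    rw [this]
    linear_combination (2 * Complex.I) * hs - 2 * q * Complex.I_sq
  rw [e, norm_mul, Complex.norm_I, one_mul]
  have b1 : ‖Complex.I * q * (1 - Complex.cos δ)‖ ≤ q * ‖δ‖ ^ 2 := by
    simp only [norm_mul, Complex.norm_I, one_mul, Complex.norm_real, Real.norm_eq_abs,
      abs_of_pos hq]
    exact mul_le_mul_of_nonneg_left (norm_one_sub_cos_le hδ1) hq.le
  have b2 : ‖w * (δ - Complex.sin δ)‖ ≤ 4 * q * ‖δ‖ ^ 2 := by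
    rw [norm_mul]
    calc ‖w‖ * ‖δ - Complex.sin δ‖ ≤ ‖w‖ * ‖δ‖ ^ 3 :=
          mul_le_mul_of_nonneg_left (norm_sub_sin_le hδ1) (norm_nonneg _)
      _ = ‖w‖ * ‖δ‖ * ‖δ‖ ^ 2 := by ring
      _ ≤ _ := mul_le_mul_of_nonneg_right h3 (sq_nonneg _)
  have b3 : ‖2 * (Complex.I * q * (1 - Complex.cos δ) + w * (δ - Complex.sin δ)) - δ ^ 2‖ ≤
      (10 * q + 1) * ‖δ‖ ^ 2 := by
    refine (norm_sub_le _ _).trans ?_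
    rw [norm_mul, norm_pow]
    have := norm_add_le (Complex.I * q * (1 - Complex.cos δ)) (w * (δ - Complex.sin δ))
    have e2 : ‖(2 : ℂ)‖ = 2 := by simp
    rw [e2]
    nlinarith
  refine b3.trans ?_
  have b4 : ‖δ‖ ^ 2 ≤ (4 * q) ^ 2 * ((n : ℝ) ^ 2)⁻¹ := by
    have := pow_le_pow_left₀ (norm_nonneg _) h4 2
    rwa [div_pow, div_eq_mul_inv] at this
  rw [mul_assoc]
  exact mul_le_mul_of_nonneg_left b4 (by positivity)

/-! ### Integration by parts, weak derivatives and primitives -/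

theorem setIntegral_Icc_eq_intervalIntegral (F : ℝ → ℂ) :
    ∫ x in Icc (0 : ℝ) 1, F x = ∫ x in (0 : ℝ)..1, F x := by
  rw [integral_Icc_eq_integral_Ioc, intervalIntegral.integral_of_le zero_le_one]

/-- Fubini on the triangle t ≤ x; g is merely integrable, so its primitive need not be
differentiable everywhere. -/
theorem integral_primitive_mul_deriv {g φ φ' : ℝ → ℂ} (hg : IntegrableOn g (Icc 0 1))
    (hφ : ∀ x, HasDerivAt φ (φ' x) x) (hφ' : Continuous φ') :
    ∫ x in (0 : ℝ)..1, (∫ t in (0 : ℝ)..x, g t) * φ' x =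
      (∫ t in (0 : ℝ)..1, g t) * φ 1 - ∫ x in (0 : ℝ)..1, g x * φ x := by
  have hφc : Continuous φ := continuous_iff_continuousAt.2 fun x => (hφ x).continuousAt
  have hg1 : IntegrableOn g (Ioc 0 1) := hg.mono_set Ioc_subset_Icc_self
  have hφ1 : IntegrableOn φ' (Ioc 0 1) :=
    (hφ'.integrableOn_Icc).mono_set Ioc_subset_Icc_self
  set ν := volume.restrict (Ioc (0 : ℝ) 1) with hν
  let S : Set (ℝ × ℝ) := {p | p.2 ≤ p.1}
  have hS : MeasurableSet S := measurableSet_le measurable_snd measurable_fst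
  have hF : Integrable (S.indicator fun p => φ' p.1 * g p.2) (ν.prod ν) :=
    (Integrable.mul_prod hφ1 hg1).indicator hS
  have hswap := integral_integral_swap (f := fun x t => S.indicator (fun p => φ' p.1 * g p.2) (x, t))
    hF
  have h1 : ∫ x in (0 : ℝ)..1, (∫ t in (0 : ℝ)..x, g t) * φ' x =
      ∫ x, ∫ t, S.indicator (fun p => φ' p.1 * g p.2) (x, t) ∂ν ∂ν := by
    rw [intervalIntegral.integral_of_le zero_le_one]
    refine setIntegral_congr_fun measurableSet_Ioc fun x hx => ?_
    have e : (fun t => S.indicator (fun p => φ' p.1 * g p.2) (x, t)) =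
        (Iic x).indicator fun t => φ' x * g t := by
      funext t; simp [S, indicator_apply]
    simp only [e]
    rw [integral_indicator measurableSet_Iic, hν, Measure.restrict_restrict measurableSet_Iic,
      integral_const_mul, intervalIntegral.integral_of_le hx.1.le, mul_comm]
    congr 3
    ext t; simp only [mem_Ioc, mem_inter_iff, mem_Iic]
    constructor
    · rintro ⟨a, b⟩; exact ⟨b, a, b.trans hx.2⟩
    · rintro ⟨a, b, c⟩; exact ⟨b, a⟩
  have h2 : ∫ t, ∫ x, S.indicator (fun p => φ' p.1 * g p.2) (x, t) ∂ν ∂ν =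
      ∫ t in Ioc (0 : ℝ) 1, (g t * φ 1 - g t * φ t) := by
    refine setIntegral_congr_fun measurableSet_Ioc fun t ht => ?_
    have e : (fun x => S.indicator (fun p => φ' p.1 * g p.2) (x, t)) =
        (Ici t).indicator fun x => φ' x * g t := by
      funext x; simp [S, indicator_apply]
    simp only [e]
    rw [integral_indicator measurableSet_Ici, hν, Measure.restrict_restrict measurableSet_Ici,
      integral_mul_const]
    have e2 : Ici t ∩ Ioc 0 1 = Icc t 1 := by
      ext x; simp only [mem_Ioc, mem_inter_iff, mem_Ici, mem_Icc]
      constructor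
      · rintro ⟨a, b, c⟩; exact ⟨a, c⟩
      · rintro ⟨a, b⟩; exact ⟨a, ht.1.trans_le a, b⟩
    rw [e2, integral_Icc_eq_integral_Ioc, ← intervalIntegral.integral_of_le ht.2,
      intervalIntegral.integral_eq_sub_of_hasDerivAt (fun x _ => hφ x)
        (hφ'.intervalIntegrable _ _)]
    ring
  rw [h1, hswap, h2, integral_sub (hg1.mul_const _) (hg.mul_continuousOn hφc.continuousOn
    isCompact_Icc |>.mono_set Ioc_subset_Icc_self), integral_mul_const,
    intervalIntegral.integral_of_le zero_le_one, intervalIntegral.integral_of_le zero_le_one]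

/-- Integration by parts for an indefinite integral `u` of `g` and a `C¹` function `φ`. -/
theorem integral_mul_deriv_of_primitive {g u φ φ' : ℝ → ℂ} (hg : IntegrableOn g (Icc 0 1))
    (hu : ∀ x ∈ Icc (0 : ℝ) 1, u x = u 0 + ∫ t in (0 : ℝ)..x, g t)
    (hφ : ∀ x, HasDerivAt φ (φ' x) x) (hφ' : Continuous φ') :
    ∫ x in (0 : ℝ)..1, u x * φ' x =
      u 1 * φ 1 - u 0 * φ 0 - ∫ x in (0 : ℝ)..1, g x * φ x := by
  have hc : ContinuousOn (fun x => ∫ t in (0 : ℝ)..x, g t) (uIcc 0 1) := by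
    have := intervalIntegral.continuousOn_primitive_interval (a := 0) (b := 1) (f := g)
      (μ := volume) (by rwa [uIcc_of_le zero_le_one])
    exact this
  have e : ∫ x in (0 : ℝ)..1, u x * φ' x =
      ∫ x in (0 : ℝ)..1, (u 0 * φ' x + (∫ t in (0 : ℝ)..x, g t) * φ' x) := by
    refine intervalIntegral.integral_congr fun x hx => ?_
    rw [uIcc_of_le zero_le_one] at hx
    simp only [hu x hx]; ring
  rw [e, intervalIntegral.integral_add ((hφ'.intervalIntegrable _ _).const_mul _)
    (ContinuousOn.intervalIntegrable (by fun_prop)), intervalIntegral.integral_const_mul,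
    integral_primitive_mul_deriv hg hφ hφ',
    intervalIntegral.integral_eq_sub_of_hasDerivAt (fun x _ => hφ x)
        (hφ'.intervalIntegrable _ _), hu 1 (by simp)]
  ring

theorem integrableOn_coeFn (f : L2I) : IntegrableOn f (Icc (0 : ℝ) 1) :=
  (Lp.memLp f).integrable (by norm_num)

theorem memLp_of_continuousOn {u : ℝ → ℂ} (hu : ContinuousOn u (Icc 0 1)) :
    MemLp u 2 (volume.restrict (Icc (0 : ℝ) 1)) := by
  obtain ⟨C, hC⟩ := isCompact_Icc.exists_bound_of_continuousOn hu
  exact MemLp.of_bound (hu.aestronglyMeasurable measurableSet_Icc) C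
    ((ae_restrict_iff' measurableSet_Icc).2 (ae_of_all _ hC))

/-- The class in `L²[0,1]` of a function that is continuous on `[0,1]`. -/
noncomputable def ofContinuousOn (u : ℝ → ℂ) (hu : ContinuousOn u (Icc 0 1)) : L2I :=
  (memLp_of_continuousOn hu).toLp u

theorem isContRep_ofContinuousOn {u : ℝ → ℂ} (hu : ContinuousOn u (Icc 0 1)) :
    IsContRep u (ofContinuousOn u hu) :=
  ⟨hu, MemLp.coeFn_toLp _⟩

theorem continuousOn_of_primitive {g u : ℝ → ℂ} (hg : IntegrableOn g (Icc 0 1))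
    (hu : ∀ x ∈ Icc (0 : ℝ) 1, u x = u 0 + ∫ t in (0 : ℝ)..x, g t) :
    ContinuousOn u (Icc 0 1) := by
  have := intervalIntegral.continuousOn_primitive_interval (a := 0) (b := 1) (f := g)
      (μ := volume) (by rwa [uIcc_of_le zero_le_one])
  rw [uIcc_of_le zero_le_one] at this
  exact (continuousOn_const.add this).congr hu

theorem isWeakDeriv_of_primitive {f g : L2I} {u : ℝ → ℂ}
    (hf : f =ᵐ[volume.restrict (Icc (0 : ℝ) 1)] u)
    (hu : ∀ x ∈ Icc (0 : ℝ) 1, u x = u 0 + ∫ t in (0 : ℝ)..x, g t) : IsWeakDeriv f g := by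
  intro θ h1 h2 h3
  have h0 : θ 0 = 0 := image_eq_zero_of_notMem_tsupport fun h => by simpa using h3 h
  have h1' : θ 1 = 0 := image_eq_zero_of_notMem_tsupport fun h => by simpa using h3 h
  have hd : ∀ x, HasDerivAt (fun x => (θ x : ℂ)) ((deriv θ x : ℝ) : ℂ) x := fun x =>
    ((h1.differentiable (by simp)) x).hasDerivAt.ofReal_comp
  have key := integral_mul_deriv_of_primitive (integrableOn_coeFn g) hu hd
    (Complex.continuous_ofReal.comp (continuous_deriv h1))
  have e1 : ∫ x in Icc (0 : ℝ) 1, deriv θ x • f x = ∫ x in (0 : ℝ)..1, u x * ((deriv θ x : ℝ) : ℂ) := by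
    rw [← setIntegral_Icc_eq_intervalIntegral]
    refine integral_congr_ae ?_
    filter_upwards [hf] with x hx
    rw [hx, Complex.real_smul, mul_comm]
  have e2 : ∫ x in Icc (0 : ℝ) 1, θ x • g x = ∫ x in (0 : ℝ)..1, g x * (θ x : ℂ) := by
    rw [← setIntegral_Icc_eq_intervalIntegral]
    simp only [Complex.real_smul, mul_comm]
  rw [e1, e2, key, h0, h1']
  simp

/-- The primitive from 0 vanishes to the left of the support of ζ, and to its right because the mean
is zero. -/
theorem exists_testFunction_deriv_eq {ζ : ℝ → ℝ} (h1 : ContDiff ℝ ∞ ζ) (h2 : HasCompactSupport ζ)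
    (h3 : tsupport ζ ⊆ Ioo 0 1) (h4 : ∫ x in (0 : ℝ)..1, ζ x = 0) :
    ∃ θ : ℝ → ℝ, ContDiff ℝ ∞ θ ∧ HasCompactSupport θ ∧ tsupport θ ⊆ Ioo 0 1 ∧ deriv θ = ζ := by
  obtain ⟨a, b, ha, hb, hab⟩ : ∃ a b : ℝ, 0 < a ∧ b < 1 ∧ tsupport ζ ⊆ Icc a b := by
    rcases (tsupport ζ).eq_empty_or_nonempty with h | h
    · exact ⟨1 / 2, 1 / 2, by norm_num, by norm_num, by simp [h]⟩
    · obtain ⟨a, ha⟩ := h2.isCompact.exists_isLeast h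
      obtain ⟨b, hb⟩ := h2.isCompact.exists_isGreatest h
      exact ⟨a, b, (h3 ha.1).1, (h3 hb.1).2, fun x hx => ⟨ha.2 hx, hb.2 hx⟩⟩
  have hz {x : ℝ} (hx : x ∉ Icc a b) : ζ x = 0 :=
    image_eq_zero_of_notMem_tsupport fun h => hx (hab h)
  have hc : Continuous ζ := h1.continuous
  have hd : ∀ x, HasDerivAt (fun x => ∫ t in (0 : ℝ)..x, ζ t) (ζ x) x := fun x =>
    intervalIntegral.integral_hasDerivAt_right (hc.intervalIntegrable _ _)
      hc.stronglyMeasurable.stronglyMeasurableAtFilter hc.continuousAt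
  have hderiv : deriv (fun x => ∫ t in (0 : ℝ)..x, ζ t) = ζ := funext fun x => (hd x).deriv
  have hsupp : tsupport (fun x => ∫ t in (0 : ℝ)..x, ζ t) ⊆ Icc a b := by
    refine closure_minimal (fun x hx => ?_) isClosed_Icc
    by_contra hx'
    refine hx ?_
    rw [mem_Icc, not_and_or, not_le, not_le] at hx'
    rcases hx' with hx' | hx'
    · refine intervalIntegral.integral_zero_ae (ae_of_all _ fun t ht => hz fun h => ?_)
      rcases le_total 0 x with h0 | h0
      · rw [uIoc_of_le h0] at ht; linarith [ht.2, h.1]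
      · rw [uIoc_of_ge h0] at ht; linarith [ht.2, h.1]
    · change ∫ t in (0 : ℝ)..x, ζ t = 0
      rw [← intervalIntegral.integral_add_adjacent_intervals (hc.intervalIntegrable 0 1)
        (hc.intervalIntegrable 1 x), h4, zero_add]
      refine intervalIntegral.integral_zero_ae (ae_of_all _ fun t ht => hz fun h => ?_)
      rcases le_total 1 x with h0 | h0
      · rw [uIoc_of_le h0] at ht; linarith [ht.1, h.2]
      · rw [uIoc_of_ge h0] at ht; linarith [ht.1, h.2]
  refine ⟨fun x => ∫ t in (0 : ℝ)..x, ζ t, ?_, ?_, ?_, hderiv⟩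
  · rw [contDiff_infty_iff_deriv, hderiv]
    exact ⟨fun x => (hd x).differentiableAt, h1⟩
  · exact isCompact_Icc.of_isClosed_subset (isClosed_tsupport _) hsupp
  · exact hsupp.trans (Icc_subset_Ioo ha hb)

/-- The du Bois-Reymond lemma: a function with vanishing weak derivative is constant. -/
theorem ae_eq_const_of_integral_deriv_smul_eq_zero {h : ℝ → ℂ} (hh : IntegrableOn h (Icc 0 1))
    (H : ∀ θ : ℝ → ℝ, ContDiff ℝ ∞ θ → HasCompactSupport θ → tsupport θ ⊆ Ioo 0 1 →
      ∫ x in Icc (0 : ℝ) 1, deriv θ x • h x = 0) :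
    ∃ c : ℂ, h =ᵐ[volume.restrict (Icc (0 : ℝ) 1)] fun _ => c := by
  let B : ContDiffBump (1 / 2 : ℝ) := ⟨1 / 8, 1 / 4, by norm_num, by norm_num⟩
  set ψ : ℝ → ℝ := B.normed volume with hψ
  have ψ1 : ContDiff ℝ ∞ ψ := B.contDiff_normed
  have ψ2 : HasCompactSupport ψ := B.hasCompactSupport_normed
  have ψ3 : tsupport ψ ⊆ Ioo 0 1 := by
    rw [hψ, B.tsupport_normed_eq, Real.closedBall_eq_Icc]
    exact Icc_subset_Ioo (by norm_num [B]) (by norm_num [B])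
  have hint {η : ℝ → ℝ} (h3 : tsupport η ⊆ Ioo 0 1) : ∫ x in (0 : ℝ)..1, η x = ∫ x, η x := by
    rw [intervalIntegral.integral_of_le zero_le_one]
    refine setIntegral_eq_integral_of_forall_compl_eq_zero fun x hx => ?_
    exact image_eq_zero_of_notMem_tsupport fun h => hx (Ioo_subset_Ioc_self (h3 h))
  have ψ4 : ∫ x in (0 : ℝ)..1, ψ x = 1 := by rw [hint ψ3]; exact B.integral_normed
  have hsm {η : ℝ → ℝ} (hη : Continuous η) :
      Integrable (fun x => η x • h x) (volume.restrict (Icc (0 : ℝ) 1)) :=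
    hh.continuousOn_smul hη.continuousOn isCompact_Icc
  set c := ∫ x in Icc (0 : ℝ) 1, ψ x • h x with hc
  refine ⟨c, ?_⟩
  have key : ∀ᵐ x ∂(volume.restrict (Icc (0 : ℝ) 1)), x ∈ Ioo (0 : ℝ) 1 → h x - c = 0 := by
    refine isOpen_Ioo.ae_eq_zero_of_integral_contDiff_smul_eq_zero ?_ ?_
    · exact (Integrable.sub hh (integrable_const c)).locallyIntegrable.locallyIntegrableOn _
    · intro η h1 h2 h3
      -- Subtracting m times the unit-mass bump ψ makes η mean zero, hence the derivative of a test
      -- function.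
      set m := ∫ x in (0 : ℝ)..1, η x with hm
      have hζs : tsupport (η - m • ψ) ⊆ tsupport η ∪ tsupport ψ := by
        refine closure_minimal (fun x hx => ?_) ((isClosed_tsupport _).union (isClosed_tsupport _))
        by_contra hx'
        rw [mem_union, not_or] at hx'
        refine hx ?_
        simp [image_eq_zero_of_notMem_tsupport hx'.1, image_eq_zero_of_notMem_tsupport hx'.2]
      obtain ⟨θ, t1, t2, t3, t4⟩ := exists_testFunction_deriv_eq (ζ := η - m • ψ)
        (h1.sub (ψ1.const_smul m))
        ((h2.isCompact.union ψ2.isCompact).of_isClosed_subset (isClosed_tsupport _) hζs)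
        (hζs.trans (union_subset h3 ψ3)) (by
          simp only [Pi.sub_apply, Pi.smul_apply, smul_eq_mul]
          rw [intervalIntegral.integral_sub (h1.continuous.intervalIntegrable _ _)
            ((ψ1.continuous.intervalIntegrable _ _).const_mul _),
            intervalIntegral.integral_const_mul, ψ4, mul_one, hm, sub_self])
      have h5 := H θ t1 t2 t3
      rw [t4] at h5
      have h6 : ∫ x in Icc (0 : ℝ) 1, (η - m • ψ) x • h x =
          (∫ x in Icc (0 : ℝ) 1, η x • h x) - m • c := by
        rw [hc, ← integral_smul, ← integral_sub (hsm h1.continuous)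
          (g := fun x => m • ψ x • h x) ((hsm ψ1.continuous).smul m)]
        refine integral_congr_ae (ae_of_all _ fun x => ?_)
        simp only [Pi.sub_apply, Pi.smul_apply, smul_eq_mul, sub_smul, mul_smul]
      have h7 : ∫ x in Icc (0 : ℝ) 1, η x • c = m • c := by
        rw [integral_smul_const, integral_Icc_eq_integral_Ioc,
          ← intervalIntegral.integral_of_le zero_le_one]
      simp only [smul_sub]
      rw [integral_sub (hsm h1.continuous)
        ((h1.continuous.integrableOn_Icc).smul_const c), h7, ← h6, h5]
  have hI : ∀ᵐ x ∂(volume.restrict (Icc (0 : ℝ) 1)), x ∈ Ioo (0 : ℝ) 1 := by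
    rw [← restrict_Ioo_eq_restrict_Icc]
    exact ae_restrict_mem measurableSet_Ioo
  filter_upwards [key, hI] with x hx hx'
  exact sub_eq_zero.1 (hx hx')

/-- The continuous representative of a function with weak derivative `g` is an indefinite
integral of `g`. -/
theorem IsWeakDeriv.eq_primitive {f g : L2I} (h : IsWeakDeriv f g) {u : ℝ → ℂ}
    (hu : IsContRep u f) : ∀ x ∈ Icc (0 : ℝ) 1, u x = u 0 + ∫ t in (0 : ℝ)..x, g t := by
  have hg := integrableOn_coeFn g
  have hpc : ContinuousOn (fun x => ∫ t in (0 : ℝ)..x, g t) (Icc 0 1) :=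
    continuousOn_of_primitive hg fun x _ => by simp
  have hF := isContRep_ofContinuousOn hpc
  set F := ofContinuousOn _ hpc
  have hFd : IsWeakDeriv F g := isWeakDeriv_of_primitive hF.2 fun x _ => by simp
  have hd : IsWeakDeriv (f + (-1 : ℂ) • F) (g + (-1 : ℂ) • g) := h.add (hFd.smul (-1))
  rw [neg_one_smul ℂ g, add_neg_cancel] at hd
  obtain ⟨c, hc⟩ := ae_eq_const_of_integral_deriv_smul_eq_zero
    (integrableOn_coeFn (f + (-1 : ℂ) • F)) fun θ h1 h2 h3 => by
      rw [hd θ h1 h2 h3, IsWeakDeriv.zero θ h1 h2 h3 |>.symm.trans ?_]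
      have e := integral_smul_smul 0 0 (deriv θ)
      rwa [zero_smul, zero_smul] at e
  have hrep := hu.add (hF.smul (-1))
  have hcr : IsContRep (fun _ => c) (f + (-1 : ℂ) • F) := ⟨continuousOn_const, hc⟩
  have heq := hrep.eqOn hcr
  intro x hx
  have e1 := heq hx
  have e0 := heq (left_mem_Icc.2 zero_le_one)
  simp only [Pi.add_apply, Pi.smul_apply, smul_eq_mul, intervalIntegral.integral_same] at e1 e0
  linear_combination e1 - e0

theorem setIntegral_norm_le (f : L2I) : ∫ x in Icc (0 : ℝ) 1, ‖f x‖ ≤ ‖f‖ := by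
  have : IsProbabilityMeasure (volume.restrict (Icc (0 : ℝ) 1)) := ⟨by simp⟩
  have h1 : eLpNorm f 1 (volume.restrict (Icc (0 : ℝ) 1)) ≤
      eLpNorm f 2 (volume.restrict (Icc (0 : ℝ) 1)) :=
    eLpNorm_le_eLpNorm_of_exponent_le (by norm_num) (Lp.aestronglyMeasurable f)
  rw [Lp.norm_def]
  rw [eLpNorm_one_eq_lintegral_enorm, ← ofReal_integral_norm_eq_lintegral_enorm
    (integrableOn_coeFn f)] at h1
  exact (ENNReal.ofReal_le_iff_le_toReal (Lp.eLpNorm_ne_top f)).1 h1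

theorem norm_intervalIntegral_le (f : L2I) {x y : ℝ} (hx : x ∈ Icc (0 : ℝ) 1)
    (hy : y ∈ Icc (0 : ℝ) 1) : ‖∫ t in x..y, f t‖ ≤ ‖f‖ := by
  refine (intervalIntegral.norm_integral_le_integral_norm_uIoc).trans
    (le_trans ?_ (setIntegral_norm_le f))
  refine setIntegral_mono_set (integrableOn_coeFn f).norm (ae_of_all _ fun _ => norm_nonneg _)
    (LE.le.eventuallyLE ?_)
  exact (uIoc_subset_uIcc).trans (uIcc_subset_Icc hx hy)

theorem integral_congr_of_isContRep {u : ℝ → ℂ} {f : L2I} (h : IsContRep u f) (φ : ℝ → ℂ) :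
    ∫ x in (0 : ℝ)..1, f x * φ x = ∫ x in (0 : ℝ)..1, u x * φ x := by
  rw [← setIntegral_Icc_eq_intervalIntegral, ← setIntegral_Icc_eq_intervalIntegral]
  refine integral_congr_ae ?_
  filter_upwards [h.2] with x hx
  rw [hx]

/-! ### Eigenfunctions, bilinear symmetry and surjectivity -/

theorem opA_apply {q : ℝ} (f : (opA q).domain) {g k : L2I} (hg : IsWeakDeriv f g)
    (hk : IsWeakDeriv g k) : opA q f = -Complex.I • k := by
  rw [← secondDeriv_eq (q := q) f hg hk]; rfl

/-- The representatives of an element of the domain and of its derivative, as indefinite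
integrals. -/
theorem exists_rep_of_mem_domain {q : ℝ} (f : (opA q).domain) :
    ∃ (g : L2I) (u v : ℝ → ℂ), IsContRep u f ∧ IsContRep v g ∧
      (∀ x ∈ Icc (0 : ℝ) 1, u x = u 0 + ∫ t in (0 : ℝ)..x, g t) ∧
      (∀ x ∈ Icc (0 : ℝ) 1, v x = v 0 + ∫ t in (0 : ℝ)..x, (Complex.I • opA q f) t) ∧
      v 0 = -Complex.I * q * u 0 ∧ v 1 = 0 := by
  obtain ⟨g, k, u, v, a, b, hu, hv, e0, e1⟩ := f.2
  refine ⟨g, u, v, hu, hv, a.eq_primitive hu, ?_, e0, e1⟩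
  have : Complex.I • opA q f = k := by
    rw [opA_apply f a b, smul_smul, mul_neg, Complex.I_mul_I, neg_neg, one_smul]
  rw [this]
  exact b.eq_primitive hv

theorem intervalIntegral_smul_coeFn (c : ℂ) (f : L2I) (φ : ℝ → ℂ) :
    ∫ x in (0 : ℝ)..1, (c • f : L2I) x * φ x = c * ∫ x in (0 : ℝ)..1, f x * φ x := by
  rw [← setIntegral_Icc_eq_intervalIntegral, ← setIntegral_Icc_eq_intervalIntegral,
    ← integral_const_mul]
  refine integral_congr_ae ?_
  filter_upwards [Lp.coeFn_smul c f] with x hx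
  rw [hx, Pi.smul_apply, smul_eq_mul, mul_assoc]

/-- `x ↦ cos (w (1 - x))`. -/
noncomputable def cosMode (w : ℂ) (x : ℝ) : ℂ := Complex.cos (w * (1 - x))

/-- The derivative `x ↦ w sin (w (1 - x))` of `cosMode w`. -/
noncomputable def cosModeDeriv (w : ℂ) (x : ℝ) : ℂ := w * Complex.sin (w * (1 - x))

theorem continuous_cosMode (w : ℂ) : Continuous (cosMode w) := by unfold cosMode; fun_prop

theorem continuous_cosModeDeriv (w : ℂ) : Continuous (cosModeDeriv w) := by
  unfold cosModeDeriv; fun_prop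

theorem hasDerivAt_mul_one_sub (w z : ℂ) :
    HasDerivAt (fun z : ℂ => w * (1 - z)) (-w) z := by
  simpa using ((hasDerivAt_id z).const_sub 1).const_mul w

theorem hasDerivAt_cosMode (w : ℂ) (x : ℝ) : HasDerivAt (cosMode w) (cosModeDeriv w x) x := by
  have h := (hasDerivAt_mul_one_sub w x).ccos.comp_ofReal
  unfold cosMode cosModeDeriv
  convert h using 1
  ring

theorem hasDerivAt_cosModeDeriv (w : ℂ) (x : ℝ) :
    HasDerivAt (cosModeDeriv w) (-w ^ 2 * cosMode w x) x := by
  have h := ((hasDerivAt_mul_one_sub w x).csin.const_mul w).comp_ofReal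
  unfold cosMode cosModeDeriv
  convert h using 1
  ring

@[simp] theorem cosMode_one (w : ℂ) : cosMode w 1 = 1 := by simp [cosMode]
@[simp] theorem cosMode_zero (w : ℂ) : cosMode w 0 = Complex.cos w := by simp [cosMode]
@[simp] theorem cosModeDeriv_one (w : ℂ) : cosModeDeriv w 1 = 0 := by simp [cosModeDeriv]
@[simp] theorem cosModeDeriv_zero (w : ℂ) : cosModeDeriv w 0 = w * Complex.sin w := by
  simp [cosModeDeriv]

/-- Symmetry of the operator with respect to the bilinear form `∫ f g`, tested on an
eigenfunction. -/
theorem integral_opA_mul_cosMode {q : ℝ} {w : ℂ} (hw : IsCharRoot q w) (f : (opA q).domain) :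
    ∫ x in (0 : ℝ)..1, opA q f x * cosMode w x =
      Complex.I * w ^ 2 * ∫ x in (0 : ℝ)..1, (f : L2I) x * cosMode w x := by
  obtain ⟨g, u, v, hu, hv, pu, pv, e0, e1⟩ := exists_rep_of_mem_domain f
  have i1 := integral_mul_deriv_of_primitive (integrableOn_coeFn _) pv (hasDerivAt_cosMode w)
    (continuous_cosModeDeriv w)
  have i2 := integral_mul_deriv_of_primitive (integrableOn_coeFn _) pu (hasDerivAt_cosModeDeriv w)
    ((continuous_cosMode w).const_mul _)
  rw [integral_congr_of_isContRep hv] at i2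
  rw [intervalIntegral_smul_coeFn] at i1
  rw [integral_congr_of_isContRep hu]
  have i3 : ∫ x in (0 : ℝ)..1, u x * (-w ^ 2 * cosMode w x) =
      -w ^ 2 * ∫ x in (0 : ℝ)..1, u x * cosMode w x := by
    rw [← intervalIntegral.integral_const_mul]
    refine intervalIntegral.integral_congr fun x _ => ?_
    ring
  rw [i3] at i2
  simp only [cosMode_one, cosMode_zero, cosModeDeriv_one, cosModeDeriv_zero, e1] at i1 i2
  unfold IsCharRoot at hw
  -- The boundary terms at 1 vanish since both derivatives do; those at 0 cancel by the boundary
  -- condition on f and the characteristic equation.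
  linear_combination (-Complex.I) * i1 + Complex.I * i2 +
    (∫ x in (0 : ℝ)..1, opA q f x * cosMode w x) * Complex.I_sq - Complex.I * u 0 * hw +
    Complex.I * Complex.cos w * e0

/-- Integrating f'' from 1, where f' vanishes, bounds f' uniformly by ‖A f‖. The condition at 0 then
bounds f(0) with the factor 1/q, and one more integration reaches f(1). No ‖f‖ term is needed. -/
theorem norm_pointValue_one_le {q : ℝ} (hq : 0 < q) (f : (opA q).domain) :
    ‖obsC q f‖ ≤ (1 / q + 1) * ‖opA q f‖ := by
  obtain ⟨g, u, v, hu, hv, pu, pv, e0, e1⟩ := exists_rep_of_mem_domain f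
  have h0 : (0 : ℝ) ∈ Icc (0 : ℝ) 1 := by simp
  have h1 : (1 : ℝ) ∈ Icc (0 : ℝ) 1 := by simp
  set k := Complex.I • opA q f with hk
  have hkn : ‖k‖ = ‖opA q f‖ := by rw [hk, norm_smul, Complex.norm_I, one_mul]
  have hi : IntervalIntegrable k volume 0 1 := by
    rw [intervalIntegrable_iff_integrableOn_Icc_of_le zero_le_one]; exact integrableOn_coeFn k
  have hvx : ∀ x ∈ Icc (0 : ℝ) 1, v x = ∫ t in (1 : ℝ)..x, k t := by
    intro x hx
    have hi2 : IntervalIntegrable k volume 0 x :=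
      hi.mono_set (by rw [uIcc_of_le zero_le_one]; exact uIcc_subset_Icc h0 hx)
    rw [pv x hx, ← intervalIntegral.integral_add_adjacent_intervals hi.symm hi2,
      intervalIntegral.integral_symm 0 1]
    have := pv 1 h1
    rw [e1] at this
    linear_combination -this
  have hvb : ∀ x ∈ Icc (0 : ℝ) 1, ‖v x‖ ≤ ‖opA q f‖ := fun x hx => by
    rw [hvx x hx, ← hkn]; exact norm_intervalIntegral_le k h1 hx
  have hu0 : ‖u 0‖ ≤ 1 / q * ‖opA q f‖ := by
    have := hvb 0 h0
    rw [e0, norm_mul, norm_mul, norm_neg, Complex.norm_I, one_mul, Complex.norm_real,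
      Real.norm_eq_abs, abs_of_pos hq] at this
    rw [one_div, inv_mul_eq_div, le_div_iff₀ hq]
    linarith
  have hgi : ‖∫ t in (0 : ℝ)..1, g t‖ ≤ ‖opA q f‖ := by
    have e : ∫ t in (0 : ℝ)..1, g t = ∫ t in (0 : ℝ)..1, v t := by
      simpa using integral_congr_of_isContRep hv fun _ => 1
    rw [e]
    have := intervalIntegral.norm_integral_le_of_norm_le_const (a := 0) (b := 1)
      (f := v) (C := ‖opA q f‖) fun x hx => hvb x (by
        rw [uIoc_of_le zero_le_one] at hx; exact Ioc_subset_Icc_self hx)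
    simpa using this
  have hobs : obsC q f = u 1 := pointValue_eq hu h1
  rw [hobs, pu 1 h1]
  refine (norm_add_le _ _).trans ?_
  linarith

theorem exists_opA_eq {q : ℝ} (hq : q ≠ 0) (y : L2I) : ∃ f : (opA q).domain, opA q f = y := by
  set k := Complex.I • y with hk
  -- The integration constant is fixed by f'(1) = 0; that of u below is fixed by f'(0) = -i q f(0),
  -- which requires q ≠ 0.
  let v : ℝ → ℂ := fun x => (-∫ t in (0 : ℝ)..1, k t) + ∫ t in (0 : ℝ)..x, k t
  have pv : ∀ x ∈ Icc (0 : ℝ) 1, v x = v 0 + ∫ t in (0 : ℝ)..x, k t := fun x _ => by simp [v]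
  have hv := isContRep_ofContinuousOn (continuousOn_of_primitive (integrableOn_coeFn k) pv)
  set g := ofContinuousOn v _
  let u : ℝ → ℂ := fun x => Complex.I * v 0 / q + ∫ t in (0 : ℝ)..x, g t
  have pu : ∀ x ∈ Icc (0 : ℝ) 1, u x = u 0 + ∫ t in (0 : ℝ)..x, g t := fun x _ => by simp [u]
  have hu := isContRep_ofContinuousOn (continuousOn_of_primitive (integrableOn_coeFn g) pu)
  set f := ofContinuousOn u _
  have a : IsWeakDeriv f g := isWeakDeriv_of_primitive hu.2 pu
  have b : IsWeakDeriv g k := isWeakDeriv_of_primitive hv.2 pv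
  have hq' : (q : ℂ) ≠ 0 := by exact_mod_cast hq
  have hf : f ∈ (opA q).domain := by
    refine ⟨g, k, u, v, a, b, hu, hv, ?_, by simp [v]⟩
    simp only [u, intervalIntegral.integral_same, add_zero]
    generalize v 0 = z
    field_simp
    linear_combination z * Complex.I_sq
  refine ⟨⟨f, hf⟩, ?_⟩
  rw [opA_apply ⟨f, hf⟩ a b, hk, smul_smul, neg_mul, Complex.I_mul_I, neg_neg, one_smul]

/-- The class of `cosMode w` in `L²[0,1]`. -/
noncomputable def cosVec (w : ℂ) : L2I := ofContinuousOn (cosMode w) (continuous_cosMode w).continuousOn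

theorem isContRep_cosVec (w : ℂ) : IsContRep (cosMode w) (cosVec w) :=
  isContRep_ofContinuousOn _

theorem cosVec_eigen {q : ℝ} {w : ℂ} (hw : IsCharRoot q w) :
    ∃ h : cosVec w ∈ (opA q).domain, opA q ⟨cosVec w, h⟩ = (Complex.I * w ^ 2) • cosVec w := by
  have hg := isContRep_ofContinuousOn (continuous_cosModeDeriv w).continuousOn (u := cosModeDeriv w)
  set g := ofContinuousOn (cosModeDeriv w) _
  have hk := (isContRep_cosVec w).smul (-w ^ 2)
  have hprim {u u' : ℝ → ℂ} {g : L2I} (hd : ∀ x, HasDerivAt u (u' x) x) (hc : Continuous u')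
      (hg : IsContRep u' g) : ∀ x ∈ Icc (0 : ℝ) 1, u x = u 0 + ∫ t in (0 : ℝ)..x, g t := by
    intro x hx
    have e : ∫ t in (0 : ℝ)..x, g t = ∫ t in (0 : ℝ)..x, u' t := by
      rw [intervalIntegral.integral_of_le hx.1, intervalIntegral.integral_of_le hx.1]
      exact integral_congr_ae (ae_restrict_of_ae_restrict_of_subset
        (Ioc_subset_Icc_self.trans (Icc_subset_Icc_right hx.2)) hg.2)
    rw [e, intervalIntegral.integral_eq_sub_of_hasDerivAt (fun x _ => hd x)
      (hc.intervalIntegrable _ _)]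
    ring
  have a : IsWeakDeriv (cosVec w) g := isWeakDeriv_of_primitive (isContRep_cosVec w).2
    (hprim (hasDerivAt_cosMode w) (continuous_cosModeDeriv w) hg)
  have b : IsWeakDeriv g (-w ^ 2 • cosVec w) := isWeakDeriv_of_primitive hg.2
    (hprim (hasDerivAt_cosModeDeriv w) ((continuous_cosMode w).const_mul _) hk)
  have h : cosVec w ∈ (opA q).domain :=
    ⟨g, _, _, _, a, b, isContRep_cosVec w, hg,
      by rw [cosMode_zero, cosModeDeriv_zero]; exact hw, by simp⟩
  refine ⟨h, ?_⟩
  rw [opA_apply ⟨_, h⟩ a b, smul_smul]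
  congr 1; ring

/-- The continuous functional `f ↦ ∫ f cos (w (1 - x))`. -/
noncomputable def cosPairing (w : ℂ) : L2I →L[ℂ] ℂ :=
  innerSL ℂ (ofContinuousOn (fun x => starRingEnd ℂ (cosMode w x))
    (Complex.continuous_conj.comp (continuous_cosMode w)).continuousOn)

theorem cosPairing_apply (w : ℂ) (f : L2I) :
    cosPairing w f = ∫ x in (0 : ℝ)..1, f x * cosMode w x := by
  rw [cosPairing, innerSL_apply_apply, L2.inner_def, ← setIntegral_Icc_eq_intervalIntegral]
  refine integral_congr_ae ?_
  filter_upwards [(isContRep_ofContinuousOn (u := fun x => starRingEnd ℂ (cosMode w x))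
    (Complex.continuous_conj.comp (continuous_cosMode w)).continuousOn).2] with x hx
  rw [hx]
  simp

theorem cosPairing_opA {q : ℝ} {w : ℂ} (hw : IsCharRoot q w) (f : (opA q).domain) :
    cosPairing w (opA q f) = Complex.I * w ^ 2 * cosPairing w f := by
  rw [cosPairing_apply, cosPairing_apply, integral_opA_mul_cosMode hw]

/-- The usual orthogonality argument for a symmetric operator, with the bilinear form replacing the
inner product. -/
theorem cosPairing_cosVec_of_ne {q : ℝ} {w z : ℂ} (hw : IsCharRoot q w) (hz : IsCharRoot q z)
    (h : w ^ 2 ≠ z ^ 2) : cosPairing w (cosVec z) = 0 := by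
  obtain ⟨hm, he⟩ := cosVec_eigen hz
  have h1 := cosPairing_opA hw ⟨_, hm⟩
  rw [he, map_smul, smul_eq_mul] at h1
  have h2 : Complex.I * (z ^ 2 - w ^ 2) * cosPairing w (cosVec z) = 0 := by
    linear_combination h1
  refine (mul_eq_zero.1 h2).resolve_left (mul_ne_zero Complex.I_ne_zero (sub_ne_zero.2 h.symm))

theorem cosPairing_cosVec_self {w : ℂ} (hw : w ≠ 0) :
    cosPairing w (cosVec w) = (2 * w + Complex.sin (2 * w)) / (4 * w) := by
  rw [cosPairing_apply, integral_congr_of_isContRep (isContRep_cosVec w)]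
  have hd : ∀ x : ℝ, HasDerivAt
      (fun x : ℝ => (x : ℂ) / 2 - Complex.sin (2 * w * (1 - x)) / (4 * w))
      (cosMode w x * cosMode w x) x := by
    intro x
    have h := (((hasDerivAt_id (x : ℂ)).div_const 2).sub
      (((hasDerivAt_mul_one_sub (2 * w) x).csin).div_const (4 * w))).comp_ofReal
    refine h.congr_deriv ?_
    have e : 2 * w * (1 - (x : ℂ)) = 2 * (w * (1 - x)) := by ring
    rw [e, Complex.cos_two_mul, cosMode]
    field_simp
    ring
  rw [intervalIntegral.integral_eq_sub_of_hasDerivAt (fun x _ => hd x)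
    (((continuous_cosMode w).mul (continuous_cosMode w)).intervalIntegrable _ _)]
  simp
  field_simp
  ring

/-! ### Riesz bases by compact perturbation of an orthonormal basis -/

section RieszBasis

variable {H : Type*} [NormedAddCommGroup H] [InnerProductSpace ℂ H]

theorem isCompactOperator_sum {ι E F : Type*} [NormedAddCommGroup E] [NormedSpace ℂ E]
    [NormedAddCommGroup F] [NormedSpace ℂ F] (s : Finset ι) {T : ι → E →L[ℂ] F}
    (hT : ∀ i ∈ s, IsCompactOperator (T i)) : IsCompactOperator (∑ i ∈ s, T i : E →L[ℂ] F) := by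
  classical
  induction s using Finset.induction_on with
  | empty => simpa using isCompactOperator_zero
  | insert a s ha ih =>
    rw [Finset.sum_insert ha]
    exact (hT a (Finset.mem_insert_self _ _)).add
      (ih fun i hi => hT i (Finset.mem_insert_of_mem hi))

theorem isCompactOperator_smulRight {E F : Type*} [NormedAddCommGroup E] [NormedSpace ℂ E]
    [NormedAddCommGroup F] [NormedSpace ℂ F] (l : E →L[ℂ] ℂ) (y : F) :
    IsCompactOperator (l.smulRight y : E →L[ℂ] F) := by
  have h : IsCompactOperator (ContinuousLinearMap.toSpanSingleton ℂ y) :=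
    isCompactOperator_of_locallyCompactSpace_rng _
  exact h.comp_clm l

/-- Cauchy–Schwarz and Bessel. This Hilbert–Schmidt bound gives operator-norm convergence of the
rank-one series. -/
theorem norm_sum_smulRight_le (b : HilbertBasis ℕ ℂ H) (d : ℕ → H) (t : Finset ℕ) :
    ‖∑ n ∈ t, (innerSL ℂ (b n)).smulRight (d n)‖ ≤ √(∑ n ∈ t, ‖d n‖ ^ 2) := by
  refine ContinuousLinearMap.opNorm_le_bound _ (Real.sqrt_nonneg _) fun x => ?_
  rw [_root_.sum_apply]
  calc ‖∑ n ∈ t, (innerSL ℂ (b n)).smulRight (d n) x‖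
      ≤ ∑ n ∈ t, ‖d n‖ * ‖inner ℂ (b n) x‖ := by
        refine norm_sum_le_of_le _ fun n _ => ?_
        rw [ContinuousLinearMap.smulRight_apply, innerSL_apply_apply, norm_smul, mul_comm]
    _ ≤ √(∑ n ∈ t, ‖d n‖ ^ 2) * √(∑ n ∈ t, ‖inner ℂ (b n) x‖ ^ 2) :=
        Real.sum_mul_le_sqrt_mul_sqrt _ _ _
    _ ≤ √(∑ n ∈ t, ‖d n‖ ^ 2) * ‖x‖ := by
        gcongr
        rw [Real.sqrt_le_left (norm_nonneg _)]
        exact b.orthonormal.sum_inner_products_le x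

/-- A square summable sequence is the image of a Hilbert basis under a compact operator. -/
theorem exists_isCompactOperator_apply_eq [CompleteSpace H] (b : HilbertBasis ℕ ℂ H) {d : ℕ → H}
    (hd : Summable fun n => ‖d n‖ ^ 2) :
    ∃ K : H →L[ℂ] H, IsCompactOperator K ∧ ∀ n, K (b n) = d n := by
  set T : ℕ → H →L[ℂ] H := fun n => (innerSL ℂ (b n)).smulRight (d n) with hT
  have hs : Summable T := by
    rw [summable_iff_vanishing_norm]
    intro ε hε
    obtain ⟨s, hs⟩ := summable_iff_vanishing_norm.1 hd (ε ^ 2) (by positivity)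
    refine ⟨s, fun t ht => (norm_sum_smulRight_le b d t).trans_lt ?_⟩
    rw [Real.sqrt_lt' hε]
    exact (le_abs_self _).trans_lt (hs t ht)
  refine ⟨∑' n, T n, ?_, fun m => ?_⟩
  · exact isCompactOperator_of_tendsto hs.hasSum
      (Eventually.of_forall fun s => isCompactOperator_sum s fun i _ =>
        isCompactOperator_smulRight _ _)
  · have h1 := (ContinuousLinearMap.apply ℂ H (b m)).hasSum hs.hasSum
    have h2 : HasSum (fun n => (ContinuousLinearMap.apply ℂ H (b m)) (T n)) (T m (b m)) := by
      refine hasSum_single m fun n hn => ?_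
      have := b.orthonormal.2 hn
      simp [hT, this]
    have h3 := h1.unique h2
    rw [ContinuousLinearMap.apply_apply] at h3
    rw [h3]
    simp [hT, b.orthonormal.1 m]

/-- A sequence which is quadratically close to an orthonormal basis and has a biorthogonal system
is a Riesz basis. -/
theorem exists_equiv_of_quadratically_close [CompleteSpace H] (b : HilbertBasis ℕ ℂ H)
    {φ : ℕ → H} (hd : Summable fun n => ‖φ n - b n‖ ^ 2) (L : ℕ → H →L[ℂ] ℂ)
    (hL : ∀ m n, m ≠ n → L m (φ n) = 0) (hL' : ∀ n, L n (φ n) ≠ 0) :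
    ∃ Q : H ≃L[ℂ] lp (fun _ : ℕ => ℂ) 2, (∀ n, Q (φ n) = lp.single 2 n (1 : ℂ)) ∧
      ∀ x n, L n x = L n (φ n) * Q x n := by
  obtain ⟨K, hK, hKb⟩ := exists_isCompactOperator_apply_eq b hd
  have hSb (n : ℕ) : (1 + K) (b n) = φ n := by
    rw [_root_.add_apply, one_apply_eq_self, hKb]; abel
  -- Expanding x in the basis b, biorthogonality kills all terms but the m-th. This yields
  -- injectivity now and the coordinate formula at the end.
  have hLS (x : H) (m : ℕ) : L m ((1 + K) x) = L m (φ m) * b.repr x m := by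
    have h1 := ((L m).comp (1 + K)).hasSum (b.hasSum_repr x)
    have h2 : HasSum (fun n => ((L m).comp (1 + K)) (b.repr x n • b n))
        (((L m).comp (1 + K)) (b.repr x m • b m)) := by
      refine hasSum_single m fun n hn => ?_
      rw [map_smul, ContinuousLinearMap.comp_apply, hSb, hL m n hn.symm, smul_zero]
    have h3 := h1.unique h2
    rw [map_smul, ContinuousLinearMap.comp_apply, ContinuousLinearMap.comp_apply, hSb,
      smul_eq_mul, mul_comm] at h3
    exact h3
  have hinj (x : H) (hx : (1 + K) x = 0) : x = 0 := by
    have : b.repr x = 0 := by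
      refine lp.ext (funext fun m => ?_)
      have h := hLS x m
      rw [hx, map_zero] at h
      simpa using (mul_eq_zero.1 h.symm).resolve_left (hL' m)
    simpa using this
  have hunit : IsUnit (1 + K) := by
    -- Fredholm alternative at -1: an eigenvector of K would lie in the kernel of 1 + K.
    rcases hK.hasEigenvalue_or_mem_resolventSet (μ := (-1 : ℂ)) (by norm_num) with h | h
    · obtain ⟨x, hx⟩ := h.exists_hasEigenvector
      refine absurd (hinj x ?_) hx.2
      have := hx.apply_eq_smul
      rw [_root_.add_apply, one_apply_eq_self]
      have h2 : K x = (-1 : ℂ) • x := this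
      rw [h2]; simp
    · rw [spectrum.mem_resolventSet_iff] at h
      rw [← IsUnit.neg_iff]
      convert h using 1
      ext x
      simp [sub_eq_add_neg, add_comm]
  obtain ⟨u, hu⟩ := hunit
  let e := ContinuousLinearEquiv.ofUnit u
  have he (x : H) : e x = (1 + K) x := by rw [← hu]; rfl
  have heb (n : ℕ) : e.symm (φ n) = b n := by rw [← hSb, ← he, e.symm_apply_apply]
  refine ⟨e.symm.trans b.repr.toContinuousLinearEquiv, fun n => ?_, fun x n => ?_⟩
  · rw [ContinuousLinearEquiv.trans_apply, heb]
    exact b.repr_self n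
  · have h := hLS (e.symm x) n
    rw [← he, e.apply_symm_apply] at h
    exact h

end RieszBasis

/-! ### The Neumann cosine basis -/

theorem isCharRoot_zero_nat_mul_pi (n : ℕ) : IsCharRoot 0 (n * Real.pi) := by
  simp [IsCharRoot, Complex.sin_nat_mul_pi]

theorem inner_cosVec_ofReal (r : ℝ) (f : L2I) : inner ℂ (cosVec r) f = cosPairing r f := by
  have h : (fun x => starRingEnd ℂ (cosMode r x)) = cosMode r := by
    funext x
    have : cosMode r x = (Real.cos (r * (1 - x)) : ℝ) := by simp [cosMode]
    rw [this, Complex.conj_ofReal]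
  rw [cosPairing, innerSL_apply_apply]
  simp only [h, cosVec]

/-- The factor normalizing `cos (n π (1 - x))` in `L²[0,1]`. -/
noncomputable def modeNormalization (n : ℕ) : ℂ := if n = 0 then 1 else (√2 : ℝ)

theorem norm_modeNormalization_le (n : ℕ) : ‖modeNormalization n‖ ≤ 2 := by
  unfold modeNormalization
  split_ifs
  · simp
  · rw [Complex.norm_real, Real.norm_eq_abs, abs_of_nonneg (Real.sqrt_nonneg _),
      Real.sqrt_le_left (by norm_num)]
    norm_num

theorem modeNormalization_ne_zero (n : ℕ) : modeNormalization n ≠ 0 := by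
  unfold modeNormalization
  split_ifs <;> simp

/-- The numbers n π are characteristic roots for q = 0, so the pairing formulas for eigenfunctions
apply; for real frequencies the bilinear pairing agrees with the inner product. -/
theorem orthonormal_cosVec :
    Orthonormal ℂ fun n : ℕ => modeNormalization n • cosVec (n * Real.pi) := by
  rw [orthonormal_iff_ite]
  intro m n
  have e : (m * Real.pi : ℂ) = ((m * Real.pi : ℝ) : ℂ) := by push_cast; rfl
  rw [inner_smul_left, inner_smul_right, e, inner_cosVec_ofReal, ← e]
  split_ifs with h
  · subst h
    rcases eq_or_ne m 0 with rfl | hm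
    · have : cosPairing 0 (cosVec 0) = 1 := by
        rw [cosPairing_apply, integral_congr_of_isContRep (isContRep_cosVec 0)]
        simp [cosMode]
      simp [modeNormalization, this]
    · have h1 : (m : ℂ) * Real.pi ≠ 0 := by
        simp [hm, Real.pi_ne_zero]
      have h2 : 2 * ((m : ℂ) * Real.pi) = (2 * m : ℕ) * Real.pi := by push_cast; ring
      rw [cosPairing_cosVec_self h1, h2, Complex.sin_nat_mul_pi, ← h2, modeNormalization,
        if_neg hm, Complex.conj_ofReal]
      have h3 : ((√2 : ℝ) : ℂ) * (√2 : ℝ) = 2 := by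
        rw [← Complex.ofReal_mul, Real.mul_self_sqrt (by norm_num)]; simp
      have h4 : (2 * ((m : ℂ) * Real.pi) + 0) / (4 * ((m : ℂ) * Real.pi)) = 1 / 2 := by
        field_simp; ring
      rw [h4]
      linear_combination (1 / 2) * h3
  · rw [cosPairing_cosVec_of_ne (isCharRoot_zero_nat_mul_pi m) (isCharRoot_zero_nat_mul_pi n)]
    · simp
    · intro h2
      apply h
      have h3 : ((m : ℂ) ^ 2) * (Real.pi : ℂ) ^ 2 = (n : ℂ) ^ 2 * (Real.pi : ℂ) ^ 2 := by
        linear_combination h2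
      have h4 := mul_right_cancel₀ (pow_ne_zero 2 (by simp [Real.pi_ne_zero])) h3
      have h5 : m ^ 2 = n ^ 2 := by exact_mod_cast h4
      exact Nat.pow_left_injective (by norm_num : 2 ≠ 0) h5

theorem intervalIntegrable_coeFn_mul (f : L2I) {φ : ℝ → ℂ} (hφ : Continuous φ) :
    IntervalIntegrable (fun x => f x * φ x) volume 0 1 := by
  rw [intervalIntegrable_iff_integrableOn_Icc_of_le zero_le_one]
  exact (integrableOn_coeFn f).mul_continuousOn hφ.continuousOn isCompact_Icc

/-- The formula 2 cos α cos β = cos (α + β) + cos (α - β) trades one power of the cosine for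
frequencies n ± 1, so annihilating all modes implies annihilating all polynomials in cos (π (1 -
x)). -/
theorem integral_mul_cos_pow_mul_cosMode {f : L2I}
    (hf : ∀ n : ℕ, cosPairing (n * Real.pi) f = 0) (k n : ℕ) :
    ∫ x in (0 : ℝ)..1, f x * (cosMode Real.pi x ^ k * cosMode (n * Real.pi) x) = 0 := by
  induction k generalizing n with
  | zero => simpa [cosPairing_apply] using hf n
  | succ k ih =>
    rcases n with _ | n
    · rw [← ih 1]
      refine intervalIntegral.integral_congr fun x _ => ?_
      simp [cosMode, pow_succ]
    · have hc (m : ℕ) : IntervalIntegrable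
          (fun x => f x * (cosMode Real.pi x ^ k * cosMode (m * Real.pi) x)) volume 0 1 :=
        intervalIntegrable_coeFn_mul f
          (((continuous_cosMode Real.pi).pow k).mul (continuous_cosMode (m * Real.pi)))
      have h : ∫ x in (0 : ℝ)..1,
          f x * (cosMode Real.pi x ^ (k + 1) * cosMode ((n + 1 : ℕ) * Real.pi) x) =
          ∫ x in (0 : ℝ)..1,
            ((1 / 2) * (f x * (cosMode Real.pi x ^ k * cosMode ((n + 2 : ℕ) * Real.pi) x)) +
            (1 / 2) * (f x * (cosMode Real.pi x ^ k * cosMode (n * Real.pi) x))) := by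
        refine intervalIntegral.integral_congr fun x _ => ?_
        have e : cosMode Real.pi x * cosMode ((n + 1 : ℕ) * Real.pi) x =
            (cosMode ((n + 2 : ℕ) * Real.pi) x + cosMode (n * Real.pi) x) / 2 := by
          simp only [cosMode]
          have e1 : ((n + 2 : ℕ) : ℂ) * Real.pi * (1 - x) =
              ((n + 1 : ℕ) : ℂ) * Real.pi * (1 - x) + Real.pi * (1 - x) := by push_cast; ring
          have e2 : (n : ℂ) * Real.pi * (1 - x) =
              ((n + 1 : ℕ) : ℂ) * Real.pi * (1 - x) - Real.pi * (1 - x) := by push_cast; ring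
          rw [e1, e2, Complex.cos_add, Complex.cos_sub]
          ring
        linear_combination f x * cosMode Real.pi x ^ k * e
      rw [h, intervalIntegral.integral_add ((hc _).const_mul _) ((hc _).const_mul _),
        intervalIntegral.integral_const_mul, intervalIntegral.integral_const_mul, ih, ih]
      simp

theorem integral_mul_polynomial_cos {f : L2I}
    (hf : ∀ n : ℕ, cosPairing (n * Real.pi) f = 0) (p : Polynomial ℝ) :
    ∫ x in (0 : ℝ)..1, f x * (p.eval (Real.cos (Real.pi * (1 - x))) : ℝ) = 0 := by
  have hc (p : Polynomial ℝ) := intervalIntegrable_coeFn_mul f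
    (φ := fun x => ((p.eval (Real.cos (Real.pi * (1 - x))) : ℝ) : ℂ)) (by fun_prop)
  induction p using Polynomial.induction_on' with
  | add p r hp hr =>
    simp only [Polynomial.eval_add, Complex.ofReal_add, mul_add]
    rw [intervalIntegral.integral_add (hc p) (hc r), hp, hr, add_zero]
  | monomial n a =>
    have h := integral_mul_cos_pow_mul_cosMode hf n 0
    have e : ∫ x in (0 : ℝ)..1,
        f x * (((Polynomial.monomial n a).eval (Real.cos (Real.pi * (1 - x))) : ℝ) : ℂ) =
        ∫ x in (0 : ℝ)..1, a * (f x * (cosMode Real.pi x ^ n * cosMode ((0 : ℕ) * Real.pi) x)) := by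
      refine intervalIntegral.integral_congr fun x _ => ?_
      simp [cosMode]
      ring
    rw [e, intervalIntegral.integral_const_mul, h, mul_zero]

/-- The substitution s = cos (π (1 - x)) maps [0,1] homeomorphically to [-1,1], so Weierstrass
approximation makes polynomials in s uniformly dense. -/
theorem integral_mul_eq_zero_of_cosPairing {f : L2I}
    (hf : ∀ n : ℕ, cosPairing (n * Real.pi) f = 0) {θ : ℝ → ℝ} (hθ : Continuous θ) :
    ∫ x in (0 : ℝ)..1, f x * (θ x : ℂ) = 0 := by
  have hpi := Real.pi_pos
  rw [← norm_le_zero_iff]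
  refine le_of_forall_pos_le_add fun ε hε => ?_
  set M := ‖f‖ + 1 with hM
  have hMpos : 0 < M := by positivity
  obtain ⟨p, hp⟩ := exists_polynomial_near_of_continuousOn (-1) 1
    (fun s => θ (1 - Real.arccos s / Real.pi))
    (hθ.comp (by fun_prop)).continuousOn (ε / M) (by positivity)
  have hx : ∀ x ∈ Icc (0 : ℝ) 1,
      ‖(θ x : ℂ) - (p.eval (Real.cos (Real.pi * (1 - x))) : ℝ)‖ ≤ ε / M := by
    intro x hx
    have h := hp (Real.cos (Real.pi * (1 - x))) ⟨Real.neg_one_le_cos _, Real.cos_le_one _⟩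
    rw [Real.arccos_cos (mul_nonneg hpi.le (by linarith [hx.2])) (by nlinarith [hx.1])] at h
    have e : 1 - Real.pi * (1 - x) / Real.pi = x := by field_simp; ring
    rw [e] at h
    rw [← Complex.ofReal_sub, Complex.norm_real, Real.norm_eq_abs, abs_sub_comm]
    exact h.le
  have hpc : Continuous fun x => ((p.eval (Real.cos (Real.pi * (1 - x))) : ℝ) : ℂ) := by fun_prop
  have hθc : Continuous fun x => (θ x : ℂ) := by fun_prop
  have e : ∫ x in (0 : ℝ)..1, f x * (θ x : ℂ) =
      ∫ x in (0 : ℝ)..1, f x * ((θ x : ℂ) - (p.eval (Real.cos (Real.pi * (1 - x))) : ℝ)) := by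
    have h := intervalIntegral.integral_sub (intervalIntegrable_coeFn_mul f hθc)
      (intervalIntegrable_coeFn_mul f hpc)
    rw [integral_mul_polynomial_cos hf, sub_zero] at h
    rw [← h]
    simp only [← mul_sub]
  rw [e, ← setIntegral_Icc_eq_intervalIntegral, zero_add]
  calc _ ≤ ∫ x in Icc (0 : ℝ) 1, ‖f x‖ * (ε / M) := by
        refine norm_integral_le_of_norm_le ((integrableOn_coeFn f).norm.mul_const _) ?_
        refine (ae_restrict_iff' measurableSet_Icc).2 (ae_of_all _ fun x h => ?_)
        rw [norm_mul]
        exact mul_le_mul_of_nonneg_left (hx x h) (norm_nonneg _)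
    _ = (∫ x in Icc (0 : ℝ) 1, ‖f x‖) * (ε / M) := integral_mul_const _ _
    _ ≤ M * (ε / M) := by
        gcongr
        exact (setIntegral_norm_le f).trans (by linarith)
    _ = ε := by field_simp

/-- Orthogonality to test functions makes f a weak derivative of 0, and weak derivatives are unique.
-/
theorem eq_zero_of_cosPairing {f : L2I} (hf : ∀ n : ℕ, cosPairing (n * Real.pi) f = 0) : f = 0 := by
  refine IsWeakDeriv.unique (f := 0) (fun θ h1 h2 h3 => ?_) IsWeakDeriv.zero
  have e1 := integral_smul_smul 0 0 (deriv θ)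
  rw [zero_smul, zero_smul] at e1
  have e2 : ∫ x in Icc (0 : ℝ) 1, θ x • f x = 0 := by
    rw [setIntegral_Icc_eq_intervalIntegral, ← integral_mul_eq_zero_of_cosPairing hf h1.continuous]
    simp only [Complex.real_smul, mul_comm]
  rw [e1, e2, neg_zero]

theorem span_cosVec_orthogonal_eq_bot :
    (Submodule.span ℂ (range fun n : ℕ => modeNormalization n • cosVec (n * Real.pi)))ᗮ = ⊥ := by
  rw [Submodule.eq_bot_iff]
  intro f hf
  refine eq_zero_of_cosPairing fun n => ?_
  have h := (Submodule.mem_orthogonal _ _).1 hf _ (Submodule.subset_span ⟨n, rfl⟩)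
  have e : (n * Real.pi : ℂ) = ((n * Real.pi : ℝ) : ℂ) := by push_cast; rfl
  rw [inner_smul_left, e, inner_cosVec_ofReal, ← e] at h
  refine (mul_eq_zero.1 h).resolve_left ?_
  simpa using modeNormalization_ne_zero n

/-- The Neumann cosine basis of `L²[0,1]`. -/
noncomputable def cosBasis : HilbertBasis ℕ ℂ L2I :=
  HilbertBasis.mkOfOrthogonalEqBot orthonormal_cosVec span_cosVec_orthogonal_eq_bot

theorem cosBasis_apply (n : ℕ) : cosBasis n = modeNormalization n • cosVec (n * Real.pi) := by
  rw [cosBasis, HilbertBasis.coe_mkOfOrthogonalEqBot]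

/-! ### The Riesz basis of eigenfunctions -/

theorem norm_sin_le_cosh (z : ℂ) : ‖Complex.sin z‖ ≤ Real.cosh z.im := by
  refine le_of_sq_le_sq ?_ (Real.cosh_pos _).le
  rw [norm_sin_sq, Real.cosh_sq]
  linarith [Real.sin_sq_le_one z.re]

theorem norm_sin_le_two_mul {z : ℂ} (h : ‖z‖ ≤ 1) : ‖Complex.sin z‖ ≤ 2 * ‖z‖ := by
  have h1 := norm_sub_sin_le h
  have h2 : ‖z‖ ^ 3 ≤ ‖z‖ ^ 1 := pow_le_pow_of_le_one (norm_nonneg _) h (by norm_num)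
  have h3 := norm_sub_norm_le (Complex.sin z) z
  rw [norm_sub_rev] at h3
  linarith

theorem norm_cosVec_sub_le {w : ℂ} {r : ℝ} (h : ‖w - r‖ ≤ 1) :
    ‖cosVec w - cosVec r‖ ≤ 2 * Real.cosh 1 * ‖w - r‖ := by
  have hp : IsProbabilityMeasure (volume.restrict (Icc (0 : ℝ) 1)) := ⟨by simp⟩
  have hb : ∀ᵐ x ∂(volume.restrict (Icc (0 : ℝ) 1)),
      ‖(cosVec w - cosVec r : L2I) x‖ ≤ 2 * Real.cosh 1 * ‖w - r‖ := by
    filter_upwards [Lp.coeFn_sub (cosVec w) (cosVec r), (isContRep_cosVec w).2,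
      (isContRep_cosVec r).2, ae_restrict_mem measurableSet_Icc] with x h1 h2 h3 hx
    rw [h1, Pi.sub_apply, h2, h3, cosMode, cosMode, Complex.cos_sub_cos]
    have hx1 : ‖(1 - x : ℂ)‖ ≤ 1 := by
      rw [← Complex.ofReal_one, ← Complex.ofReal_sub, Complex.norm_real, Real.norm_eq_abs, abs_le]
      constructor <;> linarith [hx.1, hx.2]
    have e1 : (w * (1 - x) - r * (1 - x)) / 2 = (w - r) * (1 - x) / 2 := by ring
    have n1 : ‖(w * (1 - x) - r * (1 - x)) / 2‖ ≤ ‖w - r‖ / 2 := by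
      rw [e1, norm_div, norm_mul, Complex.norm_ofNat]
      gcongr
      exact mul_le_of_le_one_right (norm_nonneg _) hx1
    have n2 := norm_sin_le_two_mul (n1.trans (by linarith))
    have n3 : ‖Complex.sin ((w * (1 - x) + r * (1 - x)) / 2)‖ ≤ Real.cosh 1 := by
      refine (norm_sin_le_cosh _).trans (Real.cosh_le_cosh.2 ?_)
      have e2 : (w * (1 - x) + r * (1 - x)) / 2 =
          ((r * (1 - x) : ℝ) : ℂ) + (w * (1 - x) - r * (1 - x)) / 2 := by push_cast; ring
      rw [e2, Complex.add_im, Complex.ofReal_im, zero_add, abs_one]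
      exact (Complex.abs_im_le_norm _).trans (n1.trans (by linarith))
    rw [norm_mul, norm_mul, norm_neg, Complex.norm_ofNat]
    have hc := Real.cosh_pos 1
    calc _ ≤ 2 * Real.cosh 1 * (2 * (‖w - r‖ / 2)) := by gcongr; exact n2.trans (by gcongr)
      _ = _ := by ring
  have := Lp.norm_le_of_ae_bound (p := 2) (by have := Real.cosh_pos 1; positivity) hb
  simpa [measureUnivNNReal] using this

/-- A Riesz basis of eigenfunctions of `opA q`, with the coordinates diagonalizing `opA q`. -/
theorem exists_rieszBasis {q : ℝ} (hq : 0 < q) {w : ℕ → ℂ}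
    (h1 : ∀ n : ℕ, n * Real.pi < (w n).re) (h2 : ∀ n : ℕ, (w n).re < n * Real.pi + Real.pi / 2)
    (hw : ∀ n, IsCharRoot q (w n)) :
    ∃ Q : L2I ≃L[ℂ] lp (fun _ : ℕ => ℂ) 2,
      (∀ n, Q (modeNormalization n • cosVec (w n)) = lp.single 2 n (1 : ℂ)) ∧
      ∀ (f : (opA q).domain) (n : ℕ), Q (opA q f) n = Complex.I * w n ^ 2 * Q f n := by
  have hpi := Real.pi_pos
  have hre (n : ℕ) : 0 < (w n).re := lt_of_le_of_lt (by positivity) (h1 n)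
  -- The strips are disjoint and lie in the right half-plane, excluding w_m = w_n and w_m = -w_n
  -- respectively.
  have hinj (m n : ℕ) (hmn : m ≠ n) : w m ^ 2 ≠ w n ^ 2 := by
    intro h
    rcases sq_eq_sq_iff_eq_or_eq_neg.1 h with h | h
    · have h3 := h1 m
      have h4 := h1 n
      have h5 := h2 m
      have h6 := h2 n
      rw [h] at h3 h5
      rcases lt_or_gt_of_ne hmn with h | h
      · have : (m + 1 : ℝ) ≤ n := by exact_mod_cast h
        nlinarith
      · have : (n + 1 : ℝ) ≤ m := by exact_mod_cast h
        nlinarith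
    · have h3 := congrArg Complex.re h
      rw [Complex.neg_re] at h3
      linarith [hre m, hre n]
  have hself (n : ℕ) : cosPairing (w n) (modeNormalization n • cosVec (w n)) ≠ 0 := by
    have hw0 : w n ≠ 0 := fun h => by simpa [h] using hre n
    rw [map_smul, cosPairing_cosVec_self hw0, smul_eq_mul]
    exact mul_ne_zero (modeNormalization_ne_zero n)
      (div_ne_zero (two_mul_add_sin_ne_zero (h1 n) (h2 n)) (by simpa using hw0))
  have hd : Summable fun n => ‖modeNormalization n • cosVec (w n) - cosBasis n‖ ^ 2 := by
    refine summable_of_isBigO_nat (g := fun n => ((n : ℝ) ^ 2)⁻¹)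
      (Real.summable_nat_pow_inv.2 (by norm_num)) ?_
    refine IsBigO.of_bound ((2 * (2 * Real.cosh 1 * (4 * q))) ^ 2) ?_
    filter_upwards [eventually_ge_atTop ⌈4 * q⌉₊] with n hn
    have hn' : 4 * q ≤ n := Nat.ceil_le.1 hn
    have hn0 : (0 : ℝ) < n := by linarith
    have hδ := (hw n).norm_sub_nat_mul_pi_le hq (h1 n) (h2 n) (by linarith)
    have e : (n * Real.pi : ℂ) = ((n * Real.pi : ℝ) : ℂ) := by push_cast; rfl
    rw [e] at hδ
    have hd := norm_cosVec_sub_le (hδ.trans ((div_le_one hn0).2 hn'))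
    have hc := Real.cosh_pos 1
    have hb : ‖modeNormalization n • cosVec (w n) - cosBasis n‖ ≤
        2 * (2 * Real.cosh 1 * (4 * q)) / n := by
      rw [cosBasis_apply, ← smul_sub, norm_smul, e]
      calc _ ≤ 2 * (2 * Real.cosh 1 * (4 * q / n)) := by
            gcongr
            · exact norm_modeNormalization_le n
            · exact hd.trans (by gcongr)
        _ = _ := by ring
    rw [norm_pow, norm_norm, norm_inv, norm_pow, RCLike.norm_natCast, ← div_eq_mul_inv, ← div_pow]
    exact pow_le_pow_left₀ (norm_nonneg _) hb 2
  obtain ⟨Q, hQ1, hQ2⟩ := exists_equiv_of_quadratically_close cosBasis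
    (φ := fun n => modeNormalization n • cosVec (w n)) hd (fun n => cosPairing (w n))
    (fun m n hmn => by
      rw [map_smul, cosPairing_cosVec_of_ne (hw m) (hw n) (hinj m n hmn), smul_zero]) hself
  refine ⟨Q, hQ1, fun f n => ?_⟩
  have e := cosPairing_opA (hw n) f
  rw [hQ2, hQ2 f n] at e
  exact mul_left_cancel₀ (hself n) (by linear_combination e)

/-! ### Bounded diagonal operators on ℓ² -/

/-- The complex Hilbert space `ℓ²(ℕ)`. -/
abbrev Ell2 : Type := lp (fun _ : ℕ => ℂ) 2

theorem summable_norm_sq (x : Ell2) : Summable fun n => ‖x n‖ ^ 2 := by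
  simpa using (lp.memℓp x).summable (by norm_num)

theorem norm_sq_eq_tsum (x : Ell2) : ‖x‖ ^ 2 = ∑' n, ‖x n‖ ^ 2 := by
  simpa using lp.norm_rpow_eq_tsum (p := 2) (by norm_num) x

theorem sum_norm_sq_le (x : Ell2) (s : Finset ℕ) : ∑ n ∈ s, ‖x n‖ ^ 2 ≤ ‖x‖ ^ 2 := by
  rw [norm_sq_eq_tsum]
  exact (summable_norm_sq x).sum_le_tsum s fun _ _ => sq_nonneg _

theorem norm_mul_le_norm_smul {m : ℕ → ℂ} {C : ℝ} (hm : ∀ n, ‖m n‖ ≤ C) (x : Ell2) (n : ℕ) :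
    ‖m n * x n‖ ≤ ‖((C : ℂ) • x) n‖ := by
  rw [lp.coeFn_smul, Pi.smul_apply, norm_smul, norm_mul, Complex.norm_real]
  exact mul_le_mul_of_nonneg_right ((hm n).trans (le_abs_self _)) (norm_nonneg _)

/-- The diagonal operator on `ℓ²` with bounded diagonal `m`. -/
noncomputable def diagOp (m : ℕ → ℂ) {C : ℝ} (hm : ∀ n, ‖m n‖ ≤ C) : Ell2 →L[ℂ] Ell2 :=
  LinearMap.mkContinuous
    { toFun := fun x => ⟨fun n => m n * x n,
        (lp.memℓp ((C : ℂ) • x)).mono' (norm_mul_le_norm_smul hm x)⟩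
      map_add' := fun x y => lp.ext (funext fun n => mul_add _ _ _)
      map_smul' := fun c x => lp.ext (funext fun n => mul_left_comm _ _ _) } C
    fun x => by
      have h := lp.norm_mono (p := 2) (by norm_num)
        (x := ⟨fun n => m n * x n, (lp.memℓp ((C : ℂ) • x)).mono' (norm_mul_le_norm_smul hm x)⟩)
        (y := (C : ℂ) • x) (norm_mul_le_norm_smul hm x)
      rw [norm_smul, Complex.norm_real, Real.norm_eq_abs,
        abs_of_nonneg ((norm_nonneg _).trans (hm 0))] at h
      exact h

@[simp] theorem diagOp_apply (m : ℕ → ℂ) {C : ℝ} (hm : ∀ n, ‖m n‖ ≤ C) (x : Ell2) (n : ℕ) :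
    diagOp m hm x n = m n * x n := rfl

theorem norm_diagOp_le (m : ℕ → ℂ) {C : ℝ} (hm : ∀ n, ‖m n‖ ≤ C) : ‖diagOp m hm‖ ≤ C :=
  LinearMap.mkContinuous_norm_le _ ((norm_nonneg _).trans (hm 0)) _

/-- Norm limit of finite-rank truncations: the remainder is diagonal, bounded by the supremum of the
tail of m. -/
theorem isCompactOperator_diagOp {m : ℕ → ℂ} {C : ℝ} (hm : ∀ n, ‖m n‖ ≤ C)
    (h0 : Tendsto m atTop (𝓝 0)) : IsCompactOperator (diagOp m hm) := by
  let F : ℕ → Ell2 →L[ℂ] Ell2 := fun N => ∑ n ∈ Finset.range N,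
    (lp.evalCLM ℂ (fun _ : ℕ => ℂ) 2 n).smulRight (lp.single 2 n (m n))
  have hF (N : ℕ) (x : Ell2) (k : ℕ) : F N x k = if k < N then m k * x k else 0 := by
    simp only [F, _root_.sum_apply, lp.coeFn_sum, Finset.sum_apply,
      ContinuousLinearMap.smulRight_apply, lp.coeFn_smul, Pi.smul_apply, lp.single_apply]
    simp only [Pi.single_apply, smul_eq_mul, mul_ite, mul_zero, Finset.sum_ite_eq,
      Finset.mem_range]
    congr 1
    exact mul_comm _ _
  refine isCompactOperator_of_tendsto (F := F) (l := atTop) ?_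
    (Eventually.of_forall fun N => isCompactOperator_sum _ fun i _ => isCompactOperator_smulRight _ _)
  rw [tendsto_iff_norm_sub_tendsto_zero]
  rw [Metric.tendsto_atTop]
  intro ε hε
  obtain ⟨N, hN⟩ := Metric.tendsto_atTop.1 h0 (ε / 2) (by positivity)
  refine ⟨N, fun M hM => ?_⟩
  have hb : ∀ n, ‖(if n < M then 0 else -m n : ℂ)‖ ≤ ε / 2 := fun n => by
    split_ifs with h
    · simp; positivity
    · have := hN n (hM.trans (not_lt.1 h))
      rw [dist_zero_right] at this
      rw [norm_neg]; exact this.le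
  have e : F M - diagOp m hm = diagOp _ hb := by
    ext x k
    rw [_root_.sub_apply, lp.coeFn_sub, Pi.sub_apply, hF, diagOp_apply, diagOp_apply]
    split_ifs <;> ring
  rw [e, dist_zero_right, norm_norm]
  exact (norm_diagOp_le _ hb).trans_lt (by linarith)

/-- Dominated convergence for families of diagonal operators. -/
theorem tendsto_diagOp_apply {ι : Type*} {l : Filter ι} {m : ι → ℕ → ℂ} {C : ι → ℝ}
    (hm : ∀ i n, ‖m i n‖ ≤ C i) {m₀ : ℕ → ℂ} {C₀ : ℝ} (hm₀ : ∀ n, ‖m₀ n‖ ≤ C₀)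
    {K : ℝ} (hK : ∀ᶠ i in l, ∀ n, ‖m i n‖ ≤ K) (h : ∀ n, Tendsto (fun i => m i n) l (𝓝 (m₀ n)))
    (x : Ell2) : Tendsto (fun i => diagOp (m i) (hm i) x) l (𝓝 (diagOp m₀ hm₀ x)) := by
  rw [tendsto_iff_norm_sub_tendsto_zero]
  have h2 : Tendsto (fun i => ‖diagOp (m i) (hm i) x - diagOp m₀ hm₀ x‖ ^ 2) l (𝓝 0) := by
    have e (i : ι) : ‖diagOp (m i) (hm i) x - diagOp m₀ hm₀ x‖ ^ 2 =
        ∑' n, ‖(m i n - m₀ n) * x n‖ ^ 2 := by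
      rw [norm_sq_eq_tsum]
      refine tsum_congr fun n => ?_
      rw [lp.coeFn_sub, Pi.sub_apply, diagOp_apply, diagOp_apply, sub_mul]
    simp only [e]
    have h0 : (0 : ℝ) = ∑' _ : ℕ, (0 : ℝ) := by simp
    rw [h0]
    refine tendsto_tsum_of_dominated_convergence
      (bound := fun n => (K + C₀) ^ 2 * ‖x n‖ ^ 2) ((summable_norm_sq x).mul_left _) ?_ ?_
    · intro n
      have := (((h n).sub_const (m₀ n)).mul_const (x n)).norm.pow 2
      simpa using this
    · filter_upwards [hK] with i hi n
      rw [norm_pow, norm_norm, norm_mul, mul_pow]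
      gcongr
      exact (norm_sub_le _ _).trans (add_le_add (hi n) (hm₀ n))
  have h3 := h2.sqrt
  simpa [Real.sqrt_sq (norm_nonneg _)] using h3

/-! ### Unbounded diagonal operators: spectrum and root spaces -/

section Diagonal

variable {E : Type*} [NormedAddCommGroup E] [NormedSpace ℂ E]

/-- In the coordinates `Q`, the operator `A` is multiplication by `μ` on its maximal domain. -/
def IsDiagonal (A : E →ₗ.[ℂ] E) (Q : E ≃L[ℂ] Ell2) (μ : ℕ → ℂ) : Prop :=
  ∀ x y : E, (x, y) ∈ A.graph ↔ ∀ n, Q y n = μ n * Q x n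

/-- The operator on `E` which is diagonal in the coordinates `Q`. -/
noncomputable def conjDiag (Q : E ≃L[ℂ] Ell2) (m : ℕ → ℂ) {C : ℝ} (hm : ∀ n, ‖m n‖ ≤ C) :
    E →L[ℂ] E :=
  (Q.symm : Ell2 →L[ℂ] E).comp ((diagOp m hm).comp (Q : E →L[ℂ] Ell2))

theorem conjDiag_eq (Q : E ≃L[ℂ] Ell2) (m : ℕ → ℂ) {C : ℝ} (hm : ∀ n, ‖m n‖ ≤ C) (x : E) :
    conjDiag Q m hm x = Q.symm (diagOp m hm (Q x)) := rfl

@[simp] theorem apply_conjDiag (Q : E ≃L[ℂ] Ell2) (m : ℕ → ℂ) {C : ℝ} (hm : ∀ n, ‖m n‖ ≤ C)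
    (x : E) (n : ℕ) : Q (conjDiag Q m hm x) n = m n * Q x n := by
  rw [conjDiag_eq, Q.apply_symm_apply, diagOp_apply]

theorem ext_coord (Q : E ≃L[ℂ] Ell2) {x y : E} (h : ∀ n, Q x n = Q y n) : x = y :=
  Q.injective (lp.ext (funext h))

theorem IsDiagonal.exists_mem {A : E →ₗ.[ℂ] E} {Q : E ≃L[ℂ] Ell2} {μ : ℕ → ℂ}
    (hA : IsDiagonal A Q μ) {x y : E} (h : ∀ n, Q y n = μ n * Q x n) :
    ∃ hx : x ∈ A.domain, A ⟨x, hx⟩ = y := by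
  obtain ⟨x', h1, h2⟩ := (LinearPMap.mem_graph_iff A).1 ((hA x y).2 h)
  obtain rfl : (x' : E) = x := h1
  exact ⟨x'.2, h2⟩

theorem IsDiagonal.apply {A : E →ₗ.[ℂ] E} {Q : E ≃L[ℂ] Ell2} {μ : ℕ → ℂ}
    (hA : IsDiagonal A Q μ) (x : A.domain) (n : ℕ) : Q (A x) n = μ n * Q x n :=
  (hA _ _).1 (LinearPMap.mem_graph A x) n

theorem IsDiagonal.isBoundedInverse {A : E →ₗ.[ℂ] E} {Q : E ≃L[ℂ] Ell2} {μ : ℕ → ℂ}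
    (hA : IsDiagonal A Q μ) (h0 : ∀ n, μ n ≠ 0) {C : ℝ} (hC : ∀ n, ‖(μ n)⁻¹‖ ≤ C) :
    IsBoundedInverse A (conjDiag Q _ hC) := by
  refine ⟨fun y => hA.exists_mem fun n => ?_, fun x => ext_coord Q fun n => ?_⟩
  · rw [apply_conjDiag, mul_inv_cancel_left₀ (h0 n)]
  · rw [apply_conjDiag, hA.apply, inv_mul_cancel_left₀ (h0 n)]

theorem IsDiagonal.isResolventAt {A : E →ₗ.[ℂ] E} {Q : E ≃L[ℂ] Ell2} {μ : ℕ → ℂ}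
    (hA : IsDiagonal A Q μ) {z : ℂ} (h0 : ∀ n, μ n ≠ z) {C : ℝ} (hC : ∀ n, ‖(z - μ n)⁻¹‖ ≤ C) :
    IsResolventAt A z (conjDiag Q _ hC) := by
  have h0' (n : ℕ) : z - μ n ≠ 0 := sub_ne_zero.2 (h0 n).symm
  refine ⟨fun y => ?_, fun x => ext_coord Q fun n => ?_⟩
  · obtain ⟨h, he⟩ := hA.exists_mem (x := conjDiag Q _ hC y) (y := z • conjDiag Q _ hC y - y)
      fun n => by
        rw [map_sub, map_smul, lp.coeFn_sub, Pi.sub_apply, lp.coeFn_smul, Pi.smul_apply,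
          apply_conjDiag, smul_eq_mul]
        have := h0' n
        field_simp
        ring
    exact ⟨h, by rw [he]; abel⟩
  · rw [apply_conjDiag, map_sub, map_smul, lp.coeFn_sub, Pi.sub_apply, lp.coeFn_smul,
      Pi.smul_apply, hA.apply, smul_eq_mul, ← sub_mul, inv_mul_cancel_left₀ (h0' n)]

theorem IsDiagonal.isEigenvector {A : E →ₗ.[ℂ] E} {Q : E ≃L[ℂ] Ell2} {μ : ℕ → ℂ}
    (hA : IsDiagonal A Q μ) {φ : E} {n : ℕ} (hφ : Q φ = lp.single 2 n (1 : ℂ)) :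
    IsEigenvector A (μ n) φ := by
  refine ⟨fun h => ?_, hA.exists_mem fun k => ?_⟩
  · rw [h, map_zero] at hφ
    have := congrArg (fun x : Ell2 => x n) hφ
    simp at this
  · rw [map_smul, lp.coeFn_smul, Pi.smul_apply, smul_eq_mul, hφ, lp.single_apply]
    rcases eq_or_ne k n with rfl | h
    · rfl
    · simp [h]

theorem IsDiagonal.exists_eq_of_isEigenvalue {A : E →ₗ.[ℂ] E} {Q : E ≃L[ℂ] Ell2} {μ : ℕ → ℂ}
    (hA : IsDiagonal A Q μ) {z : ℂ} (hz : IsEigenvalue A z) : ∃ n, μ n = z := by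
  obtain ⟨f, hf, h, he⟩ := hz
  by_contra! hne
  refine hf (ext_coord Q fun n => ?_)
  have h1 := hA.apply ⟨f, h⟩ n
  rw [he, map_smul, lp.coeFn_smul, Pi.smul_apply, smul_eq_mul] at h1
  have h2 : (z - μ n) * Q f n = 0 := by rw [sub_mul, h1, sub_self]
  simpa using (mul_eq_zero.1 h2).resolve_left (sub_ne_zero.2 (hne n).symm)

/-- All but finitely many μ n are at distance at least 1 from z. The finite part is handled by
induction, keeping ε ≤ 1 so that it serves the tail too. The gap bounds resolvents and isolates
eigenvalues. -/
theorem exists_gap {μ : ℕ → ℂ} (hμ : Tendsto (fun n => ‖μ n‖) atTop atTop) (z : ℂ) :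
    ∃ ε : ℝ, 0 < ε ∧ ∀ n, μ n ≠ z → ε ≤ dist (μ n) z := by
  have hd : Tendsto (fun n => dist (μ n) z) atTop atTop := by
    refine tendsto_atTop_mono (fun n => ?_) (tendsto_atTop_add_const_right _ (-‖z‖) hμ)
    rw [dist_eq_norm]
    linarith [norm_sub_norm_le (μ n) z]
  obtain ⟨N, hN⟩ := eventually_atTop.1 (hd.eventually_ge_atTop 1)
  have hfin : ∀ N : ℕ, ∃ ε : ℝ, 0 < ε ∧ ε ≤ 1 ∧ ∀ n < N, μ n ≠ z → ε ≤ dist (μ n) z := by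
    intro N
    induction N with
    | zero => exact ⟨1, one_pos, le_rfl, fun n hn => absurd hn (Nat.not_lt_zero n)⟩
    | succ N ih =>
      obtain ⟨ε, h1, h2, h3⟩ := ih
      by_cases h : μ N = z
      · refine ⟨ε, h1, h2, fun n hn hne => ?_⟩
        rcases Nat.lt_succ_iff_lt_or_eq.1 hn with h' | rfl
        · exact h3 n h' hne
        · exact absurd h hne
      · refine ⟨min ε (dist (μ N) z), lt_min h1 (dist_pos.2 h), (min_le_left _ _).trans h2,
          fun n hn hne => ?_⟩
        rcases Nat.lt_succ_iff_lt_or_eq.1 hn with h' | rfl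
        · exact (min_le_left _ _).trans (h3 n h' hne)
        · exact min_le_right _ _
  obtain ⟨ε, h1, h2, h3⟩ := hfin N
  refine ⟨ε, h1, fun n hne => ?_⟩
  rcases lt_or_ge n N with h | h
  · exact h3 n h hne
  · exact h2.trans (hN n h)

theorem IsDiagonal.exists_eq_of_mem_opSpectrum {A : E →ₗ.[ℂ] E} {Q : E ≃L[ℂ] Ell2} {μ : ℕ → ℂ}
    (hA : IsDiagonal A Q μ) (hμ : Tendsto (fun n => ‖μ n‖) atTop atTop) {z : ℂ}
    (hz : z ∈ opSpectrum A) : ∃ n, μ n = z := by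
  by_contra! hne
  obtain ⟨ε, hε, h⟩ := exists_gap hμ z
  refine hz ⟨_, hA.isResolventAt hne (C := ε⁻¹) fun n => ?_⟩
  rw [norm_inv]
  refine inv_anti₀ hε ?_
  rw [← dist_eq_norm, dist_comm]
  exact h n (hne n)

theorem IsDiagonal.coord_eq_zero_of_mem_kerPow {A : E →ₗ.[ℂ] E} {Q : E ≃L[ℂ] Ell2} {μ : ℕ → ℂ}
    (hA : IsDiagonal A Q μ) {z : ℂ} {n : ℕ} (hn : μ n ≠ z) (k : ℕ) {x : E}
    (hx : x ∈ kerPow A z k) : Q x n = 0 := by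
  induction k generalizing x with
  | zero =>
    rw [kerPow, Submodule.mem_bot] at hx
    simp [hx]
  | succ k ih =>
    rw [kerPow, Submodule.mem_map] at hx
    obtain ⟨y, hy, rfl⟩ := hx
    have h1 := ih (Submodule.mem_comap.1 hy)
    have h2 : Q (A y - z • (y : E)) n = 0 := h1
    rw [map_sub, map_smul, lp.coeFn_sub, Pi.sub_apply, lp.coeFn_smul, Pi.smul_apply, hA.apply,
      smul_eq_mul, ← sub_mul] at h2
    exact (mul_eq_zero.1 h2).resolve_left (sub_ne_zero.2 hn)

/-- Root vectors only have coordinates with μ n = z, and these indices lie below the point where |μ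
n| exceeds |z| for good. -/
theorem IsDiagonal.finiteDimensional_rootSpace {A : E →ₗ.[ℂ] E} {Q : E ≃L[ℂ] Ell2} {μ : ℕ → ℂ}
    (hA : IsDiagonal A Q μ) (hμ : Tendsto (fun n => ‖μ n‖) atTop atTop) (z : ℂ) :
    FiniteDimensional ℂ (rootSpace A z) := by
  obtain ⟨N, hN⟩ := eventually_atTop.1 (hμ.eventually_gt_atTop ‖z‖)
  have hne (n : ℕ) (hn : N ≤ n) : μ n ≠ z := fun h => by
    have := hN n hn
    rw [h] at this
    exact lt_irrefl _ this
  let S : Submodule ℂ E := Submodule.span ℂ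
    ((fun n => Q.symm (lp.single 2 n (1 : ℂ))) '' (Finset.range N : Set ℕ))
  have hS : FiniteDimensional ℂ S :=
    FiniteDimensional.span_of_finite ℂ ((Finset.range N).finite_toSet.image _)
  have hle : rootSpace A z ≤ S := by
    refine iSup_le fun k x hx => ?_
    have e : x = ∑ n ∈ Finset.range N, Q x n • Q.symm (lp.single 2 n (1 : ℂ)) := by
      refine ext_coord Q fun m => ?_
      simp only [map_sum, map_smul, Q.apply_symm_apply, lp.coeFn_sum, Finset.sum_apply,
        lp.coeFn_smul, Pi.smul_apply, lp.single_apply, Pi.single_apply, smul_eq_mul, mul_ite,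
        mul_one, mul_zero, Finset.sum_ite_eq, Finset.mem_range]
      split_ifs with h
      · rfl
      · exact hA.coord_eq_zero_of_mem_kerPow (hne m (not_lt.1 h)) k hx
    rw [e]
    exact S.sum_mem fun n hn => S.smul_mem _ (Submodule.subset_span ⟨n, hn, rfl⟩)
  exact Submodule.finiteDimensional_of_le hle

/-! ### The group generated by a diagonal operator -/

theorem norm_exp_sub_one_le_mul_exp (z : ℂ) :
    ‖Complex.exp z - 1‖ ≤ ‖z‖ * Real.exp |z.re| := by
  have hd (s : ℝ) : HasDerivAt (fun s : ℝ => Complex.exp (s * z)) (Complex.exp (s * z) * z) s := by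
    simpa using (((hasDerivAt_id (s : ℂ)).mul_const z).cexp).comp_ofReal
  have h := (convex_Icc (0 : ℝ) 1).norm_image_sub_le_of_norm_hasDerivWithin_le
    (f := fun s : ℝ => Complex.exp (s * z)) (C := ‖z‖ * Real.exp |z.re|)
    (fun s _ => (hd s).hasDerivWithinAt) (fun s hs => by
      rw [norm_mul, Complex.norm_exp, mul_comm]
      gcongr
      rw [Complex.re_ofReal_mul]
      refine (le_abs_self _).trans ?_
      rw [abs_mul, abs_of_nonneg hs.1]
      exact mul_le_of_le_one_left (abs_nonneg _) hs.2)
    (left_mem_Icc.2 zero_le_one) (right_mem_Icc.2 zero_le_one)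
  simpa using h

theorem norm_exp_mul_le {μ : ℂ} {c : ℝ} (h : |μ.re| ≤ c) (t : ℝ) :
    ‖Complex.exp (t * μ)‖ ≤ Real.exp (|t| * c) := by
  rw [Complex.norm_exp, Complex.re_ofReal_mul]
  refine Real.exp_le_exp.2 ((le_abs_self _).trans ?_)
  rw [abs_mul]
  gcongr

/-- The group generated by a diagonal operator whose spectrum lies in a vertical strip. -/
noncomputable def diagGroup (Q : E ≃L[ℂ] Ell2) (μ : ℕ → ℂ) {c : ℝ} (hc : ∀ n, |(μ n).re| ≤ c) :
    C0Group E where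
  toFun t := conjDiag Q (fun n => Complex.exp (t * μ n)) fun n => norm_exp_mul_le (hc n) t
  map_zero := by
    ext x
    exact ext_coord Q fun n => by simp
  map_add s t := by
    ext x
    refine ext_coord Q fun n => ?_
    rw [ContinuousLinearMap.comp_apply, apply_conjDiag, apply_conjDiag, apply_conjDiag,
      Complex.ofReal_add, add_mul, Complex.exp_add, mul_assoc]
  strongCont x := by
    simp only [conjDiag_eq]
    refine Q.symm.continuous.comp (continuous_iff_continuousAt.2 fun t₀ => ?_)
    refine tendsto_diagOp_apply _ _ (K := Real.exp ((|t₀| + 1) * c)) ?_ (fun n => ?_) _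
    · have hc0 : 0 ≤ c := (abs_nonneg _).trans (hc 0)
      have hev : ∀ᶠ t in 𝓝 t₀, |t| < |t₀| + 1 :=
        (continuous_abs.tendsto t₀).eventually_lt_const (lt_add_one _)
      filter_upwards [hev] with t ht n
      refine (norm_exp_mul_le (hc n) t).trans (Real.exp_le_exp.2 ?_)
      gcongr
    · exact Continuous.tendsto (by fun_prop) t₀

theorem apply_diagGroup (Q : E ≃L[ℂ] Ell2) (μ : ℕ → ℂ) {c : ℝ} (hc : ∀ n, |(μ n).re| ≤ c)
    (t : ℝ) (x : E) (n : ℕ) :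
    Q ((diagGroup Q μ hc).toFun t x) n = Complex.exp (t * μ n) * Q x n :=
  apply_conjDiag _ _ _ _ _

theorem tendsto_exp_sub_one_div (μ : ℂ) :
    Tendsto (fun t : ℝ => (t : ℂ)⁻¹ * (Complex.exp (t * μ) - 1)) (𝓝[≠] 0) (𝓝 μ) := by
  have hd : HasDerivAt (fun s : ℝ => Complex.exp (s * μ)) μ 0 := by
    simpa using (((hasDerivAt_id ((0 : ℝ) : ℂ)).mul_const μ).cexp).comp_ofReal
  simpa using hd.tendsto_slope_zero

/-- The bound depends on μ only through the strip width c, so it dominates all coordinates of the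
difference quotient at once. -/
theorem norm_exp_sub_one_div_le {μ : ℂ} (hμ : μ ≠ 0) {c : ℝ} (h : |μ.re| ≤ c) (t : ℝ) :
    ‖(t : ℂ)⁻¹ * (Complex.exp (t * μ) - 1) * μ⁻¹‖ ≤ Real.exp (|t| * c) := by
  rcases eq_or_ne t 0 with rfl | ht
  · simp
  · have h1 := norm_exp_sub_one_le_mul_exp (t * μ)
    have h2 : Real.exp |((t : ℂ) * μ).re| ≤ Real.exp (|t| * c) := by
      rw [Complex.re_ofReal_mul, abs_mul]
      gcongr
    have hμ' : 0 < ‖μ‖ := norm_pos_iff.2 hμ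
    have ht' : 0 < |t| := abs_pos.2 ht
    rw [norm_mul, norm_mul, norm_inv, norm_inv, Complex.norm_real, Real.norm_eq_abs]
    rw [norm_mul, Complex.norm_real, Real.norm_eq_abs] at h1
    have h3 : ‖Complex.exp (t * μ) - 1‖ ≤ |t| * ‖μ‖ * Real.exp (|t| * c) :=
      h1.trans (by gcongr)
    rw [inv_mul_eq_div, ← div_eq_mul_inv, div_div, div_le_iff₀ (by positivity)]
    linarith

theorem IsDiagonal.isGenerator {A : E →ₗ.[ℂ] E} {Q : E ≃L[ℂ] Ell2} {μ : ℕ → ℂ}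
    (hA : IsDiagonal A Q μ) (h0 : ∀ n, μ n ≠ 0) {c : ℝ} (hc : ∀ n, |(μ n).re| ≤ c) :
    IsGenerator A (diagGroup Q μ hc) := by
  intro x y
  have hcoord (t : ℝ) (n : ℕ) :
      Q ((t : ℂ)⁻¹ • ((diagGroup Q μ hc).toFun t x - x)) n =
        (t : ℂ)⁻¹ * (Complex.exp (t * μ n) - 1) * Q x n := by
    rw [map_smul, map_sub, lp.coeFn_smul, Pi.smul_apply, lp.coeFn_sub, Pi.sub_apply,
      apply_diagGroup, smul_eq_mul]
    ring
  rw [hA]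
  constructor
  · intro h
    have hb (t : ℝ) (n : ℕ) := norm_exp_sub_one_div_le (h0 n) (hc n) t
    -- Dividing by μ n lets the quotient act on Q y instead of Q x. The multipliers (exp (t μ n) -
    -- 1) / (t μ n) are uniformly bounded near 0 and tend to 1, so dominated convergence applies.
    have e (t : ℝ) : (t : ℂ)⁻¹ • ((diagGroup Q μ hc).toFun t x - x) =
        Q.symm (diagOp _ (hb t) (Q y)) := by
      refine ext_coord Q fun n => ?_
      rw [hcoord, Q.apply_symm_apply, diagOp_apply, h, mul_assoc _ (μ n)⁻¹,
        inv_mul_cancel_left₀ (h0 n)]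
    have h1 : ∀ _ : ℕ, ‖(1 : ℂ)‖ ≤ 1 := fun _ => by simp
    have e1 : y = Q.symm (diagOp (fun _ => 1) h1 (Q y)) := by
      refine ext_coord Q fun n => ?_
      rw [Q.apply_symm_apply, diagOp_apply, one_mul]
    have key := (Q.symm.continuous.tendsto (diagOp (fun _ => 1) h1 (Q y))).comp
      (tendsto_diagOp_apply (l := 𝓝[≠] 0) hb h1 (K := Real.exp (1 * c)) ?_ (fun n => ?_) (Q y))
    · rw [← e1] at key
      exact key.congr fun t => (e t).symm
    · have hc0 : 0 ≤ c := (abs_nonneg _).trans (hc 0)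
      have hev : ∀ᶠ t : ℝ in 𝓝[≠] 0, |t| < 1 := by
        refine Filter.Eventually.filter_mono nhdsWithin_le_nhds ?_
        exact (continuous_abs.tendsto (0 : ℝ)).eventually_lt_const (by simp)
      filter_upwards [hev] with t ht n
      refine (hb t n).trans (Real.exp_le_exp.2 ?_)
      gcongr
    · have := (tendsto_exp_sub_one_div (μ n)).mul_const (μ n)⁻¹
      rwa [mul_inv_cancel₀ (h0 n)] at this
  · intro h n
    have h1 := (((lp.evalCLM ℂ (fun _ : ℕ => ℂ) 2 n).comp (Q : E →L[ℂ] Ell2)).continuous.tendsto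
      y).comp h
    have h2 : Tendsto (fun t : ℝ => (t : ℂ)⁻¹ * (Complex.exp (t * μ n) - 1) * Q x n) (𝓝[≠] 0)
        (𝓝 (Q y n)) := h1.congr fun t => hcoord t n
    exact tendsto_nhds_unique h2 ((tendsto_exp_sub_one_div (μ n)).mul_const _)

end Diagonal

/-! ### Termwise observation, nonharmonic Fourier sums and admissibility -/

section Functional

variable {E : Type*} [NormedAddCommGroup E] [NormedSpace ℂ E]

/-- A functional that is bounded in the graph norm is evaluated termwise on the expansion in
eigenvectors. -/
theorem IsDiagonal.hasSum_functional {A : E →ₗ.[ℂ] E} {Q : E ≃L[ℂ] Ell2} {μ : ℕ → ℂ}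
    (hA : IsDiagonal A Q μ) {φ : ℕ → A.domain} (hφ : ∀ n, Q (φ n) = lp.single 2 n (1 : ℂ))
    {C : A.domain →ₗ[ℂ] ℂ} {K : ℝ} (hC : ∀ x, ‖C x‖ ≤ K * ‖A x‖) (x : A.domain) :
    HasSum (fun n => Q x n * C (φ n)) (C x) := by
  have hAφ (n : ℕ) : A (φ n) = μ n • (φ n : E) := by
    obtain ⟨_, h, he⟩ := hA.isEigenvector (hφ n)
    exact he
  have hs : HasSum (fun n => Q (A x) n • (φ n : E)) (A x) := by
    have h1 := (lp.hasSum_single (p := 2) (by norm_num) (Q (A x))).mapL (Q.symm : Ell2 →L[ℂ] E)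
    have e : (fun n => (Q.symm : Ell2 →L[ℂ] E) (lp.single 2 n (Q (A x) n))) =
        fun n => Q (A x) n • (φ n : E) := by
      funext n
      have h2 : lp.single 2 n (Q (A x) n) = Q (A x) n • Q (φ n) := by
        rw [hφ, ← lp.single_smul, smul_eq_mul, mul_one]
      rw [h2, map_smul]
      congr 1
      exact Q.symm_apply_apply _
    rw [e] at h1
    convert h1 using 1
    exact (Q.symm_apply_apply _).symm
  -- Convergence of the expansion of A x is what matters: `hC` turns its error into the error for C
  -- x.
  rw [HasSum, SummationFilter.unconditional_filter, tendsto_iff_norm_sub_tendsto_zero] at hs ⊢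
  refine squeeze_zero (fun _ => norm_nonneg _) (fun s => ?_) (by simpa using hs.const_mul K)
  have h1 := hC (∑ n ∈ s, Q x n • φ n - x)
  have e1 : C (∑ n ∈ s, Q x n • φ n - x) = ∑ n ∈ s, Q x n * C (φ n) - C x := by
    simp [map_sub, map_sum]
  have e2 : A (∑ n ∈ s, Q x n • φ n - x) = ∑ n ∈ s, Q (A x) n • (φ n : E) - A x := by
    change A.toFun _ = _
    rw [map_sub, map_sum]
    congr 1
    refine Finset.sum_congr rfl fun n _ => ?_
    rw [map_smul, hA.apply]
    have := hAφ n
    rw [mul_comm, mul_smul, ← this]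
    rfl
  rwa [e1, e2] at h1

end Functional

/-- Parseval over k full periods: (n π)² · (2/π) = 2 π n², so the exponentials share the period 2/π
and are orthogonal on it. -/
theorem integral_norm_sum_exp_sq (k : ℕ) (s : Finset ℕ) (a : ℕ → ℂ) :
    ∫ t in (0 : ℝ)..(k * (2 / Real.pi)),
      ‖∑ n ∈ s, a n * Complex.exp (Complex.I * (n * Real.pi) ^ 2 * t)‖ ^ 2 =
      k * (2 / Real.pi) * ∑ n ∈ s, ‖a n‖ ^ 2 := by
  have hexp (n m : ℕ) : ∫ t in (0 : ℝ)..(k * (2 / Real.pi)),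
      Complex.exp (Complex.I * ((n * Real.pi) ^ 2 - (m * Real.pi) ^ 2) * t) =
      if n = m then (k : ℂ) * (2 / Real.pi) else 0 := by
    split_ifs with h
    · subst h; simp
    · have hpi : (Real.pi : ℂ) ≠ 0 := by simp [Real.pi_ne_zero]
      have hc : Complex.I * ((n * Real.pi) ^ 2 - (m * Real.pi) ^ 2 : ℂ) ≠ 0 := by
        refine mul_ne_zero Complex.I_ne_zero fun h0 => h ?_
        have h1 : ((n : ℂ) ^ 2) * (Real.pi : ℂ) ^ 2 = (m : ℂ) ^ 2 * (Real.pi : ℂ) ^ 2 := by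
          linear_combination h0
        have h2 := mul_right_cancel₀ (pow_ne_zero 2 hpi) h1
        exact Nat.pow_left_injective (by norm_num : 2 ≠ 0) (by exact_mod_cast h2)
      rw [integral_exp_mul_complex hc]
      have e : Complex.I * ((n * Real.pi) ^ 2 - (m * Real.pi) ^ 2 : ℂ) *
          ((k * (2 / Real.pi) : ℝ) : ℂ) =
          (((n : ℤ) ^ 2 - (m : ℤ) ^ 2) * k : ℤ) * (2 * Real.pi * Complex.I) := by
        push_cast; field_simp
      rw [e, Complex.exp_int_mul_two_pi_mul_I]
      simp
  have key : ∀ t : ℝ,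
      ((‖∑ n ∈ s, a n * Complex.exp (Complex.I * (n * Real.pi) ^ 2 * t)‖ ^ 2 : ℝ) : ℂ) =
      ∑ n ∈ s, ∑ m ∈ s, a n * starRingEnd ℂ (a m) *
        Complex.exp (Complex.I * ((n * Real.pi) ^ 2 - (m * Real.pi) ^ 2) * t) := by
    intro t
    rw [Complex.ofReal_pow, ← Complex.mul_conj', map_sum, Finset.sum_mul_sum]
    refine Finset.sum_congr rfl fun n _ => Finset.sum_congr rfl fun m _ => ?_
    have e : Complex.I * ((n * Real.pi) ^ 2 - (m * Real.pi) ^ 2 : ℂ) * t =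
        Complex.I * (n * Real.pi) ^ 2 * t + -Complex.I * (m * Real.pi) ^ 2 * t := by ring
    rw [e, Complex.exp_add, map_mul, ← Complex.exp_conj]
    simp only [map_mul, map_pow, Complex.conj_I, Complex.conj_ofReal, map_natCast]
    ring
  have hC : ((∫ t in (0 : ℝ)..(k * (2 / Real.pi)),
      ‖∑ n ∈ s, a n * Complex.exp (Complex.I * (n * Real.pi) ^ 2 * t)‖ ^ 2 : ℝ) : ℂ) =
      ((k * (2 / Real.pi) * ∑ n ∈ s, ‖a n‖ ^ 2 : ℝ) : ℂ) := by
    rw [← intervalIntegral.integral_ofReal]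
    simp only [key]
    rw [intervalIntegral.integral_finsetSum fun n _ =>
      Continuous.intervalIntegrable (by fun_prop) _ _]
    have h1 (n : ℕ) (hn : n ∈ s) : ∫ t in (0 : ℝ)..(k * (2 / Real.pi)), ∑ m ∈ s,
        a n * starRingEnd ℂ (a m) *
          Complex.exp (Complex.I * ((n * Real.pi) ^ 2 - (m * Real.pi) ^ 2) * t) =
        k * (2 / Real.pi) * (‖a n‖ ^ 2 : ℝ) := by
      rw [intervalIntegral.integral_finsetSum fun m _ =>
        Continuous.intervalIntegrable (by fun_prop) _ _]
      simp only [intervalIntegral.integral_const_mul, hexp, mul_ite, mul_zero, Finset.sum_ite_eq,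
        hn, if_true, Complex.mul_conj']
      push_cast; ring
    rw [Finset.sum_congr rfl h1, ← Finset.mul_sum]
    push_cast; rfl
  exact_mod_cast hC

/-- An `L²` bound for nonharmonic Fourier sums with exponents quadratically close to
`c + i (n π)²`. -/
theorem exists_integral_norm_sum_exp_le {μ : ℕ → ℂ} {c : ℝ}
    (hμ : Summable fun n => ‖μ n - (c + Complex.I * (n * Real.pi) ^ 2)‖ ^ 2) {τ : ℝ} (hτ : 0 < τ) :
    ∃ m : ℝ, 0 < m ∧ ∀ (s : Finset ℕ) (a : ℕ → ℂ),
      ∫ t in (0 : ℝ)..τ, ‖∑ n ∈ s, a n * Complex.exp (t * μ n)‖ ^ 2 ≤ m * ∑ n ∈ s, ‖a n‖ ^ 2 := by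
  set ε : ℕ → ℂ := fun n => μ n - (c + Complex.I * (n * Real.pi) ^ 2) with hε
  set B := ∑' n, ‖ε n‖ ^ 2 with hB
  have hB0 : 0 ≤ B := tsum_nonneg fun _ => sq_nonneg _
  have hBs (s : Finset ℕ) : ∑ n ∈ s, ‖ε n‖ ^ 2 ≤ B := hμ.sum_le_tsum s fun _ _ => sq_nonneg _
  have hεB (n : ℕ) : ‖ε n‖ ≤ √B := by
    refine Real.le_sqrt_of_sq_le ?_
    simpa using hBs {n}
  set M := Real.exp (τ * |c|) * (τ * Real.exp (τ * √B)) with hM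
  -- Enough periods to cover [0, τ].
  obtain ⟨k, hk⟩ := exists_nat_ge (τ * Real.pi / 2)
  have hpi := Real.pi_pos
  set p : ℝ := k * (2 / Real.pi) with hp
  have hτp : τ ≤ p := by
    rw [hp, ← mul_div_assoc, le_div_iff₀ hpi]; linarith
  set X := Real.exp (τ * |c|) with hX
  have hX0 : 0 < X := Real.exp_pos _
  have hM0 : 0 < M := by positivity
  refine ⟨2 * X ^ 2 * p + τ * (2 * (M ^ 2 * B)), ?_, fun s a => ?_⟩
  · have : 0 < p := hτ.trans_le hτp
    positivity
  set P : ℝ → ℂ := fun t => ∑ n ∈ s, a n * Complex.exp (Complex.I * (n * Real.pi) ^ 2 * t) with hP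
  have hPc : Continuous fun t => ‖P t‖ ^ 2 := by fun_prop
  set Y := ∑ n ∈ s, ‖a n‖ ^ 2 with hY
  have hpt : ∀ t ∈ Icc 0 τ, ‖∑ n ∈ s, a n * Complex.exp (t * μ n)‖ ^ 2 ≤
      2 * X ^ 2 * ‖P t‖ ^ 2 + 2 * (M ^ 2 * B) * Y := by
    intro t ht
    have hct : Real.exp (t * c) ≤ X := by
      refine Real.exp_le_exp.2 ?_
      calc t * c ≤ t * |c| := mul_le_mul_of_nonneg_left (le_abs_self c) ht.1
        _ ≤ τ * |c| := mul_le_mul_of_nonneg_right ht.2 (abs_nonneg c)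
    -- A periodic main part, plus an error in which exp (t ε_n) - 1 = O(|ε_n|) uniformly on [0, τ];
    -- Cauchy–Schwarz and the square summability of ε control the error pointwise in t.
    have hsplit : ∑ n ∈ s, a n * Complex.exp (t * μ n) = Complex.exp (t * c) * P t +
        ∑ n ∈ s, a n * (Complex.exp (t * c) * Complex.exp (Complex.I * (n * Real.pi) ^ 2 * t) *
          (Complex.exp (t * ε n) - 1)) := by
      rw [hP, Finset.mul_sum, ← Finset.sum_add_distrib]
      refine Finset.sum_congr rfl fun n _ => ?_
      have : (t : ℂ) * μ n = t * c + Complex.I * (n * Real.pi) ^ 2 * t + t * ε n := by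
        simp only [hε]; ring
      rw [this, Complex.exp_add, Complex.exp_add]
      ring
    have hc1 : ‖Complex.exp (t * c)‖ ≤ X := by
      rw [Complex.norm_exp, ← Complex.ofReal_mul, Complex.ofReal_re]; exact hct
    have hterm (n : ℕ) : ‖Complex.exp (t * c) * Complex.exp (Complex.I * (n * Real.pi) ^ 2 * t) *
        (Complex.exp (t * ε n) - 1)‖ ≤ M * ‖ε n‖ := by
      have h1 : ‖Complex.exp (Complex.I * (n * Real.pi) ^ 2 * t)‖ = 1 := by
        have : Complex.I * (n * Real.pi) ^ 2 * t = ((n * Real.pi) ^ 2 * t : ℝ) * Complex.I := by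
          push_cast; ring
        rw [this, Complex.norm_exp_ofReal_mul_I]
      have h2 := norm_exp_sub_one_le_mul_exp (t * ε n)
      have h3 : ‖(t : ℂ) * ε n‖ ≤ τ * ‖ε n‖ := by
        rw [norm_mul, Complex.norm_real, Real.norm_eq_abs, abs_of_nonneg ht.1]
        gcongr
        exact ht.2
      have h4 : |((t : ℂ) * ε n).re| ≤ τ * √B :=
        (Complex.abs_re_le_norm _).trans (h3.trans (by gcongr; exact hεB n))
      rw [norm_mul, norm_mul, h1, mul_one]
      calc _ ≤ X * (τ * ‖ε n‖ * Real.exp (τ * √B)) := by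
            gcongr
            exact h2.trans (by gcongr)
        _ = M * ‖ε n‖ := by rw [hM, hX]; ring
    have hD : ‖∑ n ∈ s, a n * (Complex.exp (t * c) *
        Complex.exp (Complex.I * (n * Real.pi) ^ 2 * t) * (Complex.exp (t * ε n) - 1))‖ ^ 2 ≤
        M ^ 2 * B * Y := by
      have h1 : ‖∑ n ∈ s, a n * (Complex.exp (t * c) *
          Complex.exp (Complex.I * (n * Real.pi) ^ 2 * t) * (Complex.exp (t * ε n) - 1))‖ ≤
          M * ∑ n ∈ s, ‖a n‖ * ‖ε n‖ := by
        rw [Finset.mul_sum]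
        refine norm_sum_le_of_le _ fun n _ => ?_
        rw [norm_mul]
        nlinarith [mul_le_mul_of_nonneg_left (hterm n) (norm_nonneg (a n))]
      have h2 := Finset.sum_mul_sq_le_sq_mul_sq s (fun n => ‖a n‖) (fun n => ‖ε n‖)
      calc _ ≤ (M * ∑ n ∈ s, ‖a n‖ * ‖ε n‖) ^ 2 := pow_le_pow_left₀ (norm_nonneg _) h1 2
        _ = M ^ 2 * (∑ n ∈ s, ‖a n‖ * ‖ε n‖) ^ 2 := by ring
        _ ≤ M ^ 2 * (Y * B) := by
          gcongr
          exact h2.trans (mul_le_mul_of_nonneg_left (hBs s) (Finset.sum_nonneg fun _ _ => sq_nonneg _))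
        _ = _ := by ring
    rw [hsplit]
    have hE : ‖Complex.exp (t * c) * P t‖ ^ 2 ≤ X ^ 2 * ‖P t‖ ^ 2 := by
      rw [norm_mul, mul_pow]
      gcongr
    have h3 := norm_add_le (Complex.exp (t * c) * P t) (∑ n ∈ s, a n * (Complex.exp (t * c) *
        Complex.exp (Complex.I * (n * Real.pi) ^ 2 * t) * (Complex.exp (t * ε n) - 1)))
    have h4 := pow_le_pow_left₀ (norm_nonneg _) h3 2
    have h5 := add_sq_le (a := ‖Complex.exp (t * c) * P t‖) (b := ‖∑ n ∈ s, a n * (Complex.exp (t * c) *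
        Complex.exp (Complex.I * (n * Real.pi) ^ 2 * t) * (Complex.exp (t * ε n) - 1))‖)
    linarith
  have hint : ∫ t in (0 : ℝ)..τ, ‖P t‖ ^ 2 ≤ p * Y := by
    rw [← integral_norm_sum_exp_sq k s a]
    exact intervalIntegral.integral_mono_interval le_rfl hτ.le hτp
      (ae_of_all _ fun t => sq_nonneg _) (hPc.intervalIntegrable _ _)
  calc _ ≤ ∫ t in (0 : ℝ)..τ, (2 * X ^ 2 * ‖P t‖ ^ 2 + 2 * (M ^ 2 * B) * Y) :=
        intervalIntegral.integral_mono_on hτ.le (Continuous.intervalIntegrable (by fun_prop) _ _)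
          (Continuous.intervalIntegrable (by fun_prop) _ _) hpt
    _ = 2 * X ^ 2 * (∫ t in (0 : ℝ)..τ, ‖P t‖ ^ 2) + τ * (2 * (M ^ 2 * B) * Y) := by
        rw [intervalIntegral.integral_add ((hPc.const_mul _).intervalIntegrable _ _)
          (continuous_const.intervalIntegrable _ _), intervalIntegral.integral_const_mul,
          intervalIntegral.integral_const, smul_eq_mul, sub_zero]
    _ ≤ 2 * X ^ 2 * (p * Y) + τ * (2 * (M ^ 2 * B) * Y) := by gcongr
    _ = _ := by ring

theorem IsDiagonal.isAdmissibleObservation {E : Type*} [NormedAddCommGroup E] [NormedSpace ℂ E]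
    {A : E →ₗ.[ℂ] E} {Q : E ≃L[ℂ] Ell2} {μ : ℕ → ℂ} (hA : IsDiagonal A Q μ)
    (h0 : ∀ n, μ n ≠ 0) {c : ℝ} (hc : ∀ n, |(μ n).re| ≤ c) {r : ℝ}
    (hμ : Summable fun n => ‖μ n - (r + Complex.I * (n * Real.pi) ^ 2)‖ ^ 2)
    {φ : ℕ → A.domain} (hφ : ∀ n, Q (φ n) = lp.single 2 n (1 : ℂ))
    {C : A.domain →ₗ[ℂ] ℂ} {K : ℝ} (hC : ∀ x, ‖C x‖ ≤ K * ‖A x‖)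
    {L : ℝ} (hL : ∀ n, ‖C (φ n)‖ ≤ L) :
    IsAdmissibleObservation (hA.isGenerator h0 hc) C := by
  refine ⟨⟨|K|, fun x => ?_⟩, fun τ hτ => ?_⟩
  · calc ‖C x‖ ≤ K * ‖A x‖ := hC x
      _ ≤ |K| * ‖A x‖ := by gcongr; exact le_abs_self K
      _ ≤ |K| * (‖(x : E)‖ + ‖A x‖) := by gcongr; linarith [norm_nonneg (x : E)]
  obtain ⟨m, hm, hb⟩ := exists_integral_norm_sum_exp_le hμ hτ
  set N := ‖(Q : E →L[ℂ] Ell2)‖ with hN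
  -- The summand 1 only secures strict positivity.
  refine ⟨m * (L ^ 2 * N ^ 2) + 1, by positivity, fun x => ?_⟩
  set a : ℕ → ℂ := fun n => Q x n * C (φ n) with ha
  have hlim (t : ℝ) : Tendsto (fun k => ∑ n ∈ Finset.range k, a n * Complex.exp (t * μ n)) atTop
      (𝓝 (C ⟨(diagGroup Q μ hc).toFun t x, (hA.isGenerator h0 hc).mem_domain x t⟩)) := by
    have h1 := hA.hasSum_functional hφ hC
      ⟨(diagGroup Q μ hc).toFun t x, (hA.isGenerator h0 hc).mem_domain x t⟩
    simp only [apply_diagGroup] at h1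
    refine h1.tendsto_sum_nat.congr fun k => Finset.sum_congr rfl fun n _ => ?_
    simp only [ha]; ring
  have hsum (k : ℕ) : ∑ n ∈ Finset.range k, ‖a n‖ ^ 2 ≤ L ^ 2 * N ^ 2 * ‖(x : E)‖ ^ 2 := by
    calc ∑ n ∈ Finset.range k, ‖a n‖ ^ 2 ≤ ∑ n ∈ Finset.range k, L ^ 2 * ‖Q x n‖ ^ 2 := by
          refine Finset.sum_le_sum fun n _ => ?_
          rw [norm_mul, mul_pow, mul_comm]
          gcongr
          exact hL n
      _ ≤ L ^ 2 * ‖Q x‖ ^ 2 := by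
          rw [← Finset.mul_sum]
          exact mul_le_mul_of_nonneg_left (sum_norm_sq_le _ _) (sq_nonneg _)
      _ ≤ L ^ 2 * (N * ‖(x : E)‖) ^ 2 := by
          gcongr
          exact (Q : E →L[ℂ] Ell2).le_opNorm x
      _ = _ := by ring
  have hint (k : ℕ) : ∫⁻ t in Icc 0 τ, ‖∑ n ∈ Finset.range k, a n * Complex.exp (t * μ n)‖ₑ ^ 2 ≤
      ENNReal.ofReal ((m * (L ^ 2 * N ^ 2) + 1) * ‖(x : E)‖ ^ 2) := by
    have hcont : Continuous fun t : ℝ =>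
        ‖∑ n ∈ Finset.range k, a n * Complex.exp (t * μ n)‖ ^ 2 := by fun_prop
    have e : ∀ t : ℝ, ‖∑ n ∈ Finset.range k, a n * Complex.exp (t * μ n)‖ₑ ^ 2 =
        ENNReal.ofReal (‖∑ n ∈ Finset.range k, a n * Complex.exp (t * μ n)‖ ^ 2) := fun t => by
      rw [ENNReal.ofReal_pow (norm_nonneg _), ofReal_norm]
    simp only [e]
    rw [← ofReal_integral_eq_lintegral_ofReal hcont.integrableOn_Icc
      (ae_of_all _ fun _ => sq_nonneg _), integral_Icc_eq_integral_Ioc,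
      ← intervalIntegral.integral_of_le hτ.le]
    refine ENNReal.ofReal_le_ofReal ((hb _ a).trans ?_)
    nlinarith [mul_le_mul_of_nonneg_left (hsum k) hm.le, sq_nonneg ‖(x : E)‖]
  -- Fatou's lemma: the partial sums converge pointwise in t and have uniformly bounded integrals.
  calc ∫⁻ t in Icc 0 τ,
        ‖C ⟨(diagGroup Q μ hc).toFun t x, (hA.isGenerator h0 hc).mem_domain x t⟩‖ₑ ^ 2
      = ∫⁻ t in Icc 0 τ, liminf (fun k : ℕ =>
          ‖∑ n ∈ Finset.range k, a n * Complex.exp (t * μ n)‖ₑ ^ 2) atTop := by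
        refine lintegral_congr fun t => ?_
        exact (((ENNReal.continuous_pow 2).tendsto _).comp (hlim t).enorm).liminf_eq.symm
    _ ≤ liminf (fun k : ℕ => ∫⁻ t in Icc 0 τ,
          ‖∑ n ∈ Finset.range k, a n * Complex.exp (t * μ n)‖ₑ ^ 2) atTop :=
        lintegral_liminf_le fun k => by fun_prop
    _ ≤ liminf (fun _ : ℕ => ENNReal.ofReal ((m * (L ^ 2 * N ^ 2) + 1) * ‖(x : E)‖ ^ 2)) atTop :=
        liminf_le_liminf (Eventually.of_forall hint)
    _ = _ := liminf_const _

/-! ### Diagonalization of the Schrödinger operator and conclusion -/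

theorem isDiagonal_opA {q : ℝ} (hq : q ≠ 0) {Q : L2I ≃L[ℂ] Ell2} {μ : ℕ → ℂ}
    (h0 : ∀ n, μ n ≠ 0) (hQ : ∀ (f : (opA q).domain) (n : ℕ), Q (opA q f) n = μ n * Q f n) :
    IsDiagonal (opA q) Q μ := by
  intro x y
  constructor
  · intro h n
    obtain ⟨f, h1, h2⟩ := (LinearPMap.mem_graph_iff _).1 h
    simp only at h1 h2
    rw [← h1, ← h2, hQ]
  · intro h
    -- Surjectivity supplies a preimage f of y in the domain; it has the coordinates of x because no
    -- μ n vanishes, so x itself lies in the domain.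
    obtain ⟨f, rfl⟩ := exists_opA_eq hq y
    have : (f : L2I) = x := ext_coord Q fun n => by
      have h1 := h n
      rw [hQ] at h1
      exact mul_left_cancel₀ (h0 n) h1
    rw [← this]
    exact LinearPMap.mem_graph _ f

end SchrodingerGroup

theorem lemma3p1 (q : ℝ) (hq : 0 < q) :
    -- `A` has a compact inverse
    (∃ R : L2I →L[ℂ] L2I,
      IsBoundedInverse (opA q) R ∧ IsCompactOperator R) ∧
    -- the spectrum consists of isolated eigenvalues of finite algebraic multiplicity
    (∀ z ∈ opSpectrum (opA q),
      IsEigenvalue (opA q) z ∧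
      (∃ ε : ℝ, 0 < ε ∧ ∀ w ∈ opSpectrum (opA q),
        w ≠ z → ε ≤ dist w z) ∧
      FiniteDimensional ℂ (rootSpace (opA q) z)) ∧
    -- the eigenvalues have positive real parts and lie in a vertical strip
    (∃ c : ℝ, ∀ z : ℂ, IsEigenvalue (opA q) z →
      0 < z.re ∧ z.re ≤ c) ∧
    -- the eigenvalues `μ n`, their asymptotics, and a Riesz basis of eigenfunctions `φ n`
    (∃ (μ : ℕ → ℂ) (φ : ℕ → L2I),
      (∀ n, IsEigenvector (opA q) (μ n) (φ n)) ∧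
      (∀ z : ℂ, IsEigenvalue (opA q) z → ∃ n, μ n = z) ∧
      (fun n : ℕ => μ n - (2 * (q : ℂ) + Complex.I * ((n : ℂ) * (Real.pi : ℂ)) ^ 2))
        =O[atTop] (fun n : ℕ => ((n : ℝ) ^ 2)⁻¹) ∧
      IsRieszBasis φ) ∧
    -- `A` generates a C0-group, for which the point observation is admissible
    (∃ (T : C0Group L2I)
      (hT : IsGenerator (opA q) T),
      IsAdmissibleObservation hT (obsC q)) := by
  have hpi := Real.pi_gt_three
  choose w h1 h2 h3 hw using exists_isCharRoot hq
  obtain ⟨Q, hQ1, hQ2⟩ := exists_rieszBasis hq h1 h2 hw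
  set μ : ℕ → ℂ := fun n => Complex.I * w n ^ 2 with hμ
  set φ : ℕ → L2I := fun n => modeNormalization n • cosVec (w n) with hφ
  have hre (n : ℕ) : 0 < (w n).re := lt_of_le_of_lt (by positivity) (h1 n)
  have hμre (n : ℕ) : 0 < (μ n).re := by
    have : (μ n).re = -(2 * (w n).re * (w n).im) := by
      simp [hμ, sq, Complex.mul_im]; ring
    rw [this]
    nlinarith [mul_pos (hre n) (neg_pos.2 (h3 n))]
  have hμ0 (n : ℕ) : μ n ≠ 0 := fun h => by simpa [h] using hμre n
  have hO : (fun n : ℕ => μ n - (2 * (q : ℂ) + Complex.I * ((n : ℂ) * (Real.pi : ℂ)) ^ 2))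
      =O[atTop] (fun n : ℕ => ((n : ℝ) ^ 2)⁻¹) := by
    refine IsBigO.of_bound ((10 * q + 1) * (4 * q) ^ 2) ?_
    filter_upwards [eventually_ge_atTop ⌈4 * q⌉₊] with n hn
    rw [norm_inv, norm_pow, RCLike.norm_natCast]
    exact (hw n).norm_eigenvalue_sub_le hq (h1 n) (h2 n) (Nat.ceil_le.1 hn)
  have htop : Tendsto (fun n => ‖μ n‖) atTop atTop := by
    refine tendsto_atTop_mono (fun n => ?_) tendsto_natCast_atTop_atTop (f := fun n : ℕ => (n : ℝ))
    have hn : (n : ℝ) ≤ ‖w n‖ := by nlinarith [Complex.re_le_norm (w n), h1 n]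
    have hn2 : (n : ℝ) ≤ n ^ 2 := by exact_mod_cast Nat.le_self_pow (by norm_num) n
    simp only [hμ, norm_mul, Complex.norm_I, one_mul, norm_pow]
    nlinarith [norm_nonneg (w n), (Nat.cast_nonneg n : (0 : ℝ) ≤ n)]
  obtain ⟨c, hc⟩ : ∃ c : ℝ, ∀ n, |(μ n).re| ≤ c := by
    have hz : Tendsto (fun n : ℕ => ((n : ℝ) ^ 2)⁻¹) atTop (𝓝 0) :=
      tendsto_inv_atTop_zero.comp ((tendsto_pow_atTop (by norm_num)).comp tendsto_natCast_atTop_atTop)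
    -- The real part of μ n - 2 q - i (n π)² is Re (μ n) - 2 q; it converges, hence is bounded
    -- above.
    have ht := (Complex.continuous_re.tendsto _).comp (hO.trans_tendsto hz)
    obtain ⟨c, hc⟩ := ht.bddAbove_range
    refine ⟨c + 2 * q, fun n => ?_⟩
    have h := hc ⟨n, rfl⟩
    have e : (Complex.I * ((n : ℂ) * (Real.pi : ℂ)) ^ 2).re = 0 := by
      rw [← Complex.ofReal_natCast, ← Complex.ofReal_mul, ← Complex.ofReal_pow,
        Complex.I_mul_re, Complex.ofReal_im, neg_zero]
    have e2 : (2 * (q : ℂ)).re = 2 * q := by simp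
    simp only [Function.comp, Complex.sub_re, Complex.add_re, e, e2] at h
    rw [abs_of_pos (hμre n)]
    linarith
  have hA : IsDiagonal (opA q) Q μ := isDiagonal_opA hq.ne' hμ0 hQ2
  have heig (n : ℕ) : IsEigenvector (opA q) (μ n) (φ n) := hA.isEigenvector (hQ1 n)
  refine ⟨?_, fun z hz => ?_, ⟨c, fun z hz => ?_⟩,
    ⟨μ, φ, heig, fun z hz => hA.exists_eq_of_isEigenvalue hz, hO, Q, hQ1⟩,
    diagGroup Q μ hc, hA.isGenerator hμ0 hc, ?_⟩
  · obtain ⟨ε, hε, hgap⟩ := exists_gap htop 0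
    have hb (n : ℕ) : ‖(μ n)⁻¹‖ ≤ ε⁻¹ := by
      rw [norm_inv]
      refine inv_anti₀ hε ?_
      simpa using hgap n (hμ0 n)
    refine ⟨_, hA.isBoundedInverse hμ0 hb, ?_⟩
    have hcpt := isCompactOperator_diagOp hb
      (tendsto_inv₀_cobounded.comp (tendsto_norm_atTop_iff_cobounded.1 htop))
    exact (hcpt.comp_clm (Q : L2I →L[ℂ] Ell2)).clm_comp (Q.symm : Ell2 →L[ℂ] L2I)
  · obtain ⟨n, rfl⟩ := hA.exists_eq_of_mem_opSpectrum htop hz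
    obtain ⟨ε, hε, hgap⟩ := exists_gap htop (μ n)
    refine ⟨⟨φ n, heig n⟩, ⟨ε, hε, fun z' hz' hne => ?_⟩, hA.finiteDimensional_rootSpace htop _⟩
    obtain ⟨m, rfl⟩ := hA.exists_eq_of_mem_opSpectrum htop hz'
    exact hgap m hne
  · obtain ⟨n, rfl⟩ := hA.exists_eq_of_isEigenvalue hz
    exact ⟨hμre n, (le_abs_self _).trans (hc n)⟩
  -- Since cos (w (1 - x)) equals 1 at x = 1, the observed value of φ n is its normalizing factor, 1
  -- or √2; hence the bound 2.
  · refine hA.isAdmissibleObservation hμ0 hc (r := 2 * q) ?_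
      (φ := fun n => ⟨φ n, (heig n).2.choose⟩) hQ1 (norm_pointValue_one_le hq) (L := 2)
      fun n => ?_
    · have hs := hO.norm_left.pow 2
      refine summable_of_isBigO_nat (g := fun n : ℕ => (((n : ℝ) ^ 2)⁻¹) ^ 2) ?_
        (by push_cast; exact hs)
      have : (fun n : ℕ => (((n : ℝ) ^ 2)⁻¹) ^ 2) = fun n : ℕ => ((n : ℝ) ^ 4)⁻¹ := by
        funext n; rw [inv_pow, ← pow_mul]
      rw [this]
      exact Real.summable_nat_pow_inv.2 (by norm_num)
    · have : obsC q ⟨φ n, (heig n).2.choose⟩ = modeNormalization n := by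
        have h := pointValue_eq ((isContRep_cosVec (w n)).smul (modeNormalization n))
          (right_mem_Icc.2 zero_le_one)
        rw [Pi.smul_apply, cosMode_one, smul_eq_mul, mul_one] at h
        exact h
      rw [this]
      exact norm_modeNormalization_le n
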